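/- Let $\mathsf M$ be a set of unary diamond modalities. Modal $\mathsf M$-formulas are built from atoms $q_0,q_1,\dots$ by $\top,\neg,\vee$ and the diamonds $\lozenge\in\mathsf M$, with $\Box\varphi=\neg\lozenge\neg\varphi$; normal modal $\mathsf M$-logics are defined as usual. For $0<n<\omega$ let $$U_n^{\mathsf M}=\Big\{\bigvee_{i\le n}\Box\big(\blacksquare q_i\to\bigvee_{j\le n,\,j\ne i}\blacksquare q_j\big):\lozenge,\blacklozenge\in\mathsf M\Big\},$$ where $\Box,\blacksquare$ are the duals of $\lozenge,\blacklozenge$. A normal logic has *finite achronal width* if it contains $U_n^{\mathsf M}$ for some $n$ with $0<n<\omega$. An $\mathsf M$-BAO is a boolean algebra with a unary operator $\lozenge$ for each $\lozenge\in\mathsf M$ satisfying $\lozenge 0=0$ and $\lozenge(a+b)=\lozenge a+\lozenge b$. A variety of $\mathsf M$-BAOs is a class of $\mathsf M$-BAOs defined by a set of equations; its logic $L_V$ is the set of modal formulas whose translations into terms take the value $1$ in all algebras of $V$ under all assignments. The canonical frame $\mathcal A_+$ of an $\mathsf M$-BAO $\mathcal A$ has the ultrafilters of $\mathcal A$ as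 points, with $R_\lozenge\mu\nu$ iff $\lozenge a\in\mu$ for all $a\in\nu$; the canonical extension $\mathcal A^\sigma$ is the $\mathsf M$-BAO of all subsets of $\mathcal A_+$, with $\lozenge X=\{\mu:\exists\nu\in X\ R_\lozenge\mu\nu\}$. A variety $V$ is *totally canonical* if $\mathcal A^\sigma\in V$ for all $\mathcal A\in V$; for a cardinal $\kappa$ it is *$\kappa$-canonical* if $\mathcal A^\sigma\in V$ for all $\mathcal A\in V$ generated by a set of at most $\kappa$ elements; it is *resolved* if it is totally canonical or not $(|\mathsf M|+\omega)$-canonical. For a normal logic $L$ and a set $\alpha$ of atoms, the canonical frame of $L$ over $\alpha$ has as points the maximal $L$-consistent sets of formulas with atoms in $\alpha$ (the theorems of $L$ in these atoms being the substitution instances of members of $L$), with $R_\lozenge\Gamma\Delta$ iff $\lozenge\varphi\in\Gamma$ for all $\varphi\in\Delta$. $L$ is *$\kappa$-canonical* if it is valid in its canonical frame over every set of at most $\kappa$ atoms, and *totally canonical* if it is valid in all its canonical frames. **Theorem.** 1. If $V$ is a variety of $\mathsf M$-BAOs whose logic $L_V$ has finite achronal width, then $V$ is resolved. 2. Let $\mathsf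 M$ be countable. Every $\omega$-canonical variety of $\mathsf M$-BAOs whose logic has finite achronal width is totally canonical, and every $\omega$-canonical normal modal $\mathsf M$-logic of finite achronal width is totally canonical. 3. The following normal logics have finite achronal width: (a) for $\mathsf M=\{\lozenge\}$, every normal extension of some $K4I_n$ ($n<\omega$), of $K5_2$, or of $K5$. Here these are the smallest normal logics containing, respectively, $\lozenge\lozenge p\to\lozenge p$ together with $(\bigwedge_{i\le n}\lozenge q_i)\to\bigvee_{i,j\le n,\,i\ne j}\lozenge(q_i\wedge(q_j\vee\lozenge q_j))$; the formula $\lozenge\lozenge p\to\Box\lozenge p$; and the formula $\lozenge p\to\Box\lozenge p$; (b) for $\mathsf M=\{\lozenge,\blacklozenge\}$ with $\lozenge\neq\blacklozenge$, every linear temporal logic, that is, every normal logic containing $p\to\blacksquare\lozenge p$, $p\to\Box\blacklozenge p$, $\lozenge\lozenge p\to\lozenge p$, and, for each $\mathord{\blacktriangle}\in\{\lozenge,\blacklozenge\}$, the formula $(\mathord{\blacktriangle} q_0\wedge\mathord{\blacktriangle} q_1)\to\mathord{\blacktriangle}(q_0\wedge(q_1\vee\mathord{\blacktriangle} q_1))\vee\mathord{\blacktriangle}(q_1\wedge(q_0\vee\mathord{\blacktriangle}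 q_0))$. -/

import Mathlib

open Cardinal

universe u v w

namespace ModalCanon

/-! ### Modal formulas and normal modal logics -/

/-- Modal formulas over a set `M` of diamonds and a set `α` of atoms. -/
inductive Formula (M : Type u) (α : Type v) : Type (max u v)
  | atom : α → Formula M α
  | top : Formula M α
  | neg : Formula M α → Formula M α
  | or : Formula M α → Formula M α → Formula M α
  | dia : M → Formula M α → Formula M α

namespace Formula

variable {M : Type u} {α : Type v} {β : Type w}

def bot : Formula M α := neg top

def and (φ ψ : Formula M α) : Formula M α := neg (or (neg φ) (neg ψ))

def imp (φ ψ : Formula M α) : Formula M α := or (neg φ) ψ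

def iff (φ ψ : Formula M α) : Formula M α := and (imp φ ψ) (imp ψ φ)

def box (d : M) (φ : Formula M α) : Formula M α := neg (dia d (neg φ))

/-- Finite disjunction of a list (`⊥` for the empty list). -/
def bigOr (l : List (Formula M α)) : Formula M α := l.foldr or bot

/-- Finite conjunction of a list (`⊤` for the empty list). -/
def bigAnd (l : List (Formula M α)) : Formula M α := l.foldr and top

/-- Uniform substitution of formulas for atoms. -/
def subst (σ : α → Formula M β) : Formula M α → Formula M β
  | atom q => σ q
  | top => top
  | neg φ => neg (subst σ φ)
  | or φ ψ => or (subst σ φ) (subst σ ψ)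
  | dia d φ => dia d (subst σ φ)

/-- Truth-functional evaluation, in which atoms and formulas `◇φ` are treated as
propositional letters with truth values given by `t`. -/
def PropEval (t : Formula M α → Prop) : Formula M α → Prop
  | atom q => t (atom q)
  | top => True
  | neg φ => ¬ PropEval t φ
  | or φ ψ => PropEval t φ ∨ PropEval t ψ
  | dia d φ => t (dia d φ)

/-- Propositional tautologies (in the modal language). -/
def IsTautology (φ : Formula M α) : Prop := ∀ t : Formula M α → Prop, PropEval t φ

end Formula

open Formula

/-- Normal modal `M`-logics, in the language with atoms `q_0, q_1, ...`. -/
structure IsNormalLogic {M : Type u} (L : Set (Formula M ℕ)) : Prop where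
  taut : ∀ φ, IsTautology φ → φ ∈ L
  axiomK : ∀ d : M,
    imp (box d (imp (atom 0) (atom 1))) (imp (box d (atom 0)) (box d (atom 1))) ∈ L
  axiomDual : ∀ d : M, iff (dia d (atom 0)) (neg (box d (neg (atom 0)))) ∈ L
  mp : ∀ φ ψ, imp φ ψ ∈ L → φ ∈ L → ψ ∈ L
  gen : ∀ (d : M) (φ), φ ∈ L → box d φ ∈ L
  subst : ∀ φ (σ : ℕ → Formula M ℕ), φ ∈ L → φ.subst σ ∈ L

/-- The smallest normal modal logic containing a set of axioms. -/
def smallestNormal {M : Type u} (S : Set (Formula M ℕ)) : Set (Formula M ℕ) :=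
  {φ | ∀ L : Set (Formula M ℕ), IsNormalLogic L → S ⊆ L → φ ∈ L}

/-- The axioms `⋁_{i≤n} □(■q_i → ⋁_{j≤n, j≠i} ■q_j)`, for all pairs of modalities `d`, `b`. -/
def axiomsU (M : Type u) (n : ℕ) : Set (Formula M ℕ) :=
  {φ | ∃ d b : M, φ = bigOr ((List.range (n + 1)).map fun i =>
    box d (imp (box b (atom i))
      (bigOr (((List.range (n + 1)).filter fun j => j ≠ i).map fun j => box b (atom j)))))}

/-- Finite achronal width. -/
def FiniteAchronalWidth {M : Type u} (L : Set (Formula M ℕ)) : Prop :=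
  ∃ n : ℕ, 0 < n ∧ axiomsU M n ⊆ L

/-- Axiom `4`: `◇◇p → ◇p`. -/
def axiomFour {M : Type u} (d : M) : Formula M ℕ :=
  imp (dia d (dia d (atom 0))) (dia d (atom 0))

/-- Axiom `I_n`: `⋀_{i≤n} ◇q_i → ⋁_{i,j≤n, i≠j} ◇(q_i ∧ (q_j ∨ ◇q_j))`. -/
def axiomI {M : Type u} (d : M) (n : ℕ) : Formula M ℕ :=
  imp (bigAnd ((List.range (n + 1)).map fun i => dia d (atom i)))
    (bigOr (((List.range (n + 1) ×ˢ List.range (n + 1)).filter fun p => p.1 ≠ p.2).map fun p =>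
      dia d (Formula.and (atom p.1) (Formula.or (atom p.2) (dia d (atom p.2))))))

/-- Axiom `5_2`: `◇◇p → □◇p`. -/
def axiomFiveTwo {M : Type u} (d : M) : Formula M ℕ :=
  imp (dia d (dia d (atom 0))) (box d (dia d (atom 0)))

/-- Axiom `5`: `◇p → □◇p`. -/
def axiomFive {M : Type u} (d : M) : Formula M ℕ :=
  imp (dia d (atom 0)) (box d (dia d (atom 0)))

/-- `K4I_n`, for the modality `d`. -/
def logicK4I {M : Type u} (d : M) (n : ℕ) : Set (Formula M ℕ) :=
  smallestNormal {axiomFour d, axiomI d n}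

/-- `K5_2`, for the modality `d`. -/
def logicK52 {M : Type u} (d : M) : Set (Formula M ℕ) :=
  smallestNormal {axiomFiveTwo d}

/-- `K5`, for the modality `d`. -/
def logicK5 {M : Type u} (d : M) : Set (Formula M ℕ) :=
  smallestNormal {axiomFive d}

/-- The smallest linear temporal logic: `d` and `b` are mutually converse, `d` is transitive,
and both are linear. -/
def logicLinTemporal {M : Type u} (d b : M) : Set (Formula M ℕ) :=
  smallestNormal {imp (atom 0) (box b (dia d (atom 0))), imp (atom 0) (box d (dia b (atom 0))),
    axiomFour d, axiomI d 1, axiomI b 1}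

/-! ### Kripke frames -/

structure Frame (M : Type u) where
  carrier : Type u
  rel : M → carrier → carrier → Prop

/-- Truth at a point of the model given by `F` and the valuation `g`. -/
def Frame.Sat {M : Type u} {α : Type v} (F : Frame M) (g : α → Set F.carrier) :
    Formula M α → F.carrier → Prop
  | .atom q, x => x ∈ g q
  | .top, _ => True
  | .neg φ, x => ¬ F.Sat g φ x
  | .or φ ψ, x => F.Sat g φ x ∨ F.Sat g ψ x
  | .dia d φ, x => ∃ y, F.rel d x y ∧ F.Sat g φ y

def Frame.Valid {M : Type u} {α : Type v} (F : Frame M) (φ : Formula M α) : Prop :=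
  ∀ (g : α → Set F.carrier) (x : F.carrier), F.Sat g φ x

/-! ### Boolean algebras with operators -/

/-- An `M`-BAO: a boolean algebra with a normal additive unary operator for each `d : M`. -/
structure MBAO (M : Type u) where
  carrier : Type u
  [ba : BooleanAlgebra carrier]
  op : M → carrier → carrier
  op_bot : ∀ d, op d ⊥ = ⊥
  op_sup : ∀ d a b, op d (a ⊔ b) = op d a ⊔ op d b

attribute [instance] MBAO.ba

/-- Terms in the signature `{+, -, 0, 1} ∪ M` with variables `v_0, v_1, ...`. -/
inductive Term (M : Type u) : Type u
  | var : ℕ → Term M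
  | zero : Term M
  | one : Term M
  | neg : Term M → Term M
  | add : Term M → Term M → Term M
  | op : M → Term M → Term M

namespace Term

variable {M : Type u}

/-- The value of a term under an assignment. -/
def eval (A : MBAO M) (e : ℕ → A.carrier) : Term M → A.carrier
  | var i => e i
  | zero => ⊥
  | one => ⊤
  | neg t => (eval A e t)ᶜ
  | add s t => eval A e s ⊔ eval A e t
  | op d t => A.op d (eval A e t)

end Term

/-- The translation of modal formulas to terms. -/
def Formula.toTerm {M : Type u} : Formula M ℕ → Term M
  | .atom i => .var i
  | .top => .one
  | .neg φ => .neg φ.toTerm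
  | .or φ ψ => .add φ.toTerm ψ.toTerm
  | .dia d φ => .op d φ.toTerm

/-- A variety: a class of `M`-BAOs defined by a set of equations. -/
def IsVariety {M : Type u} (V : Set (MBAO M)) : Prop :=
  ∃ E : Set (Term M × Term M), ∀ A : MBAO M,
    A ∈ V ↔ ∀ p ∈ E, ∀ e : ℕ → A.carrier, p.1.eval A e = p.2.eval A e

/-- The set of modal formulas validated by a class of algebras. -/
def logicOf {M : Type u} (V : Set (MBAO M)) : Set (Formula M ℕ) :=
  {φ | ∀ A ∈ V, ∀ e : ℕ → A.carrier, φ.toTerm.eval A e = ⊤}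

/-! ### Canonical extensions and canonicity of varieties -/

/-- Ultrafilters of a boolean algebra. -/
def BAUltrafilter (B : Type u) [BooleanAlgebra B] : Type u :=
  {F : Order.PFilter B // ⊥ ∉ F ∧ ∀ a, a ∈ F ∨ aᶜ ∈ F}

/-- The canonical frame `A₊` of an algebra. -/
def MBAO.canonicalFrame {M : Type u} (A : MBAO M) : Frame M where
  carrier := BAUltrafilter A.carrier
  rel d μ ν := ∀ a, a ∈ ν.1 → A.op d a ∈ μ.1

/-- The algebra of all subsets of a frame. -/
def Frame.complexAlgebra {M : Type u} (F : Frame M) : MBAO M where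
  carrier := Set F.carrier
  op d X := {x | ∃ y ∈ X, F.rel d x y}
  op_bot d := by
    ext x
    simp
  op_sup d X Y := by
    ext x
    simp [or_and_right, exists_or]

/-- The canonical extension `A^σ`. -/
def MBAO.canonicalExtension {M : Type u} (A : MBAO M) : MBAO M :=
  A.canonicalFrame.complexAlgebra

/-- `T` is (the domain of) a subalgebra of `A`. -/
structure MBAO.IsSubalgebra {M : Type u} (A : MBAO M) (T : Set A.carrier) : Prop where
  bot_mem : ⊥ ∈ T
  top_mem : ⊤ ∈ T
  compl_mem : ∀ a ∈ T, aᶜ ∈ T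
  sup_mem : ∀ a ∈ T, ∀ b ∈ T, a ⊔ b ∈ T
  op_mem : ∀ d, ∀ a ∈ T, A.op d a ∈ T

/-- `A` is generated, as an algebra, by a set of cardinality at most `κ`. -/
def MBAO.IsGeneratedBy {M : Type u} (A : MBAO M) (κ : Cardinal.{u}) : Prop :=
  ∃ S : Set A.carrier, #S ≤ κ ∧ ∀ T : Set A.carrier, S ⊆ T → A.IsSubalgebra T → T = Set.univ

def TotallyCanonical {M : Type u} (V : Set (MBAO M)) : Prop :=
  ∀ A ∈ V, A.canonicalExtension ∈ V

def CanonicalInPower {M : Type u} (κ : Cardinal.{u}) (V : Set (MBAO M)) : Prop :=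
  ∀ A ∈ V, A.IsGeneratedBy κ → A.canonicalExtension ∈ V

/-- A variety is resolved if it is totally canonical or not even `(|M| + ω)`-canonical. -/
def Resolved {M : Type u} (V : Set (MBAO M)) : Prop :=
  TotallyCanonical V ∨ ¬ CanonicalInPower (#M + ℵ₀) V

/-! ### Canonical frames and canonicity of logics -/

/-- The theorems of `L` in the language with atoms `α`: the substitution instances of members
of `L`. -/
def theoremsIn {M : Type u} (L : Set (Formula M ℕ)) (α : Type u) : Set (Formula M α) :=
  {χ | ∃ φ ∈ L, ∃ σ : ℕ → Formula M α, χ = φ.subst σ}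

/-- `L`-consistency of a set of formulas with atoms in `α`. -/
def Consistent {M : Type u} (L : Set (Formula M ℕ)) {α : Type u} (Γ : Set (Formula M α)) : Prop :=
  ¬ ∃ l : List (Formula M α), (∀ ψ ∈ l, ψ ∈ Γ) ∧ neg (bigAnd l) ∈ theoremsIn L α

/-- The canonical frame of `L` over the atoms `α`: its points are the maximal `L`-consistent
sets. -/
def logicCanonicalFrame {M : Type u} (L : Set (Formula M ℕ)) (α : Type u) : Frame M where
  carrier := {Γ : Set (Formula M α) // Maximal (fun Δ => Consistent L Δ) Γ}
  rel d Γ Δ := ∀ φ, φ ∈ Δ.1 → dia d φ ∈ Γ.1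

/-- `L` is canonical in power `κ`: it is valid in its canonical frames over at most `κ` atoms. -/
def LogicCanonicalInPower {M : Type u} (κ : Cardinal.{u}) (L : Set (Formula M ℕ)) : Prop :=
  ∀ α : Type u, #α ≤ κ → ∀ φ ∈ L, (logicCanonicalFrame L α).Valid φ

/-- `L` is canonical in all powers. -/
def LogicTotallyCanonical {M : Type u} (L : Set (Formula M ℕ)) : Prop :=
  ∀ α : Type u, ∀ φ ∈ L, (logicCanonicalFrame L α).Valid φ

/-! ### The logic of a class of algebras is normal -/

theorem MBAO.exists_ultrafilter {B : Type u} [BooleanAlgebra B] {a : B} (h : a ≠ ⊤) :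
    ∃ μ : BAUltrafilter B, a ∉ μ.1 := by
  have hd : Disjoint ((Order.PFilter.principal aᶜ : Order.PFilter B) : Set B)
      ((Order.Ideal.principal a : Order.Ideal B) : Set B) := by
    rw [Set.disjoint_left]
    intro x hx hx'
    have h1 : aᶜ ≤ x := hx
    have h2 : x ≤ a := hx'
    exact h (by simpa using sup_le (le_refl a) (h1.trans h2))
  obtain ⟨J, hJ, hIJ, hFJ⟩ := DistribLattice.prime_ideal_of_disjoint_filter_ideal hd
  have hmem : ∀ x, x ∈ hJ.toPrimePair.F ↔ x ∉ J := by
    intro x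
    have := hJ.toPrimePair.compl_I_eq_F
    rw [← SetLike.mem_coe, ← this]
    rfl
  refine ⟨⟨hJ.toPrimePair.F, ?_, ?_⟩, ?_⟩
  · rw [hmem]
    exact fun hn => hn J.bot_mem
  · intro b
    rw [hmem, hmem]
    by_contra hb
    push Not at hb
    have htop : (⊤ : B) ∈ J := by simpa using Order.Ideal.sup_mem hb.1 hb.2
    exact hJ.toIsProper.ne_univ (by
      ext x
      simpa using J.lower le_top htop)
  · rw [hmem]
    exact fun hn => hn (hIJ (show a ≤ a from le_refl a))

theorem eval_eq_top_of_tautology {M : Type u} (A : MBAO M) (e : ℕ → A.carrier)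
    {φ : Formula M ℕ} (h : IsTautology φ) : φ.toTerm.eval A e = ⊤ := by
  by_contra hne
  obtain ⟨μ, hμ⟩ := MBAO.exists_ultrafilter hne
  have key : ∀ ψ : Formula M ℕ,
      PropEval (fun χ => χ.toTerm.eval A e ∈ μ.1) ψ ↔ ψ.toTerm.eval A e ∈ μ.1 := by
    intro ψ
    have hc : ∀ a, aᶜ ∈ μ.1 ↔ a ∉ μ.1 := by
      intro a
      refine ⟨fun h1 h2 => μ.2.1 ?_, fun h1 => (μ.2.2 a).resolve_left h1⟩
      simpa using Order.PFilter.inf_mem h2 h1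
    induction ψ with
    | atom q => exact Iff.rfl
    | top => simp [PropEval, Formula.toTerm, Term.eval]
    | neg ψ ih => simp [PropEval, Formula.toTerm, Term.eval, ih, hc]
    | or ψ χ ih1 ih2 =>
      simp only [PropEval, Formula.toTerm, Term.eval, ih1, ih2]
      rw [← not_iff_not, ← hc (_ ⊔ _), compl_sup, Order.PFilter.inf_mem_iff, hc, hc, not_or]
    | dia d ψ ih => exact Iff.rfl
  exact hμ ((key φ).1 (h _))

theorem toTerm_subst_eval {M : Type u} (A : MBAO M) (e : ℕ → A.carrier)
    (σ : ℕ → Formula M ℕ) (φ : Formula M ℕ) :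
    (φ.subst σ).toTerm.eval A e = φ.toTerm.eval A fun i => (σ i).toTerm.eval A e := by
  induction φ <;> simp_all [Formula.subst, Formula.toTerm, Term.eval]

theorem isNormalLogic_logicOf {M : Type u} (V : Set (MBAO M)) : IsNormalLogic (logicOf V) where
  taut φ h A _ e := eval_eq_top_of_tautology A e h
  axiomK d A _ e := by
    simp only [imp, box, Formula.toTerm, Term.eval, compl_sup, compl_compl, ← sup_assoc]
    rw [← A.op_sup, eq_top_iff, ← sup_compl_eq_top (x := A.op d (e 1)ᶜ)]
    refine sup_le_sup_right ?_ _
    have h : (e 1)ᶜ ≤ e 0 ⊓ (e 1)ᶜ ⊔ (e 0)ᶜ := by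
      rw [sup_inf_right]
      simp
    calc A.op d (e 1)ᶜ ≤ A.op d (e 1)ᶜ ⊔ A.op d (e 0 ⊓ (e 1)ᶜ ⊔ (e 0)ᶜ) := le_sup_left
      _ = _ := by rw [← A.op_sup, sup_eq_right.2 h]
  axiomDual d A _ e := by
    simp [Formula.iff, Formula.and, imp, box, Formula.toTerm, Term.eval]
  mp φ ψ h1 h2 A hA e := by
    have h1 := h1 A hA e
    have h2 := h2 A hA e
    simpa [imp, Formula.toTerm, Term.eval, h2] using h1
  gen d φ h A hA e := by
    simp [box, Formula.toTerm, Term.eval, h A hA e, A.op_bot]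
  subst φ σ h A hA e := by
    rw [toTerm_subst_eval]
    exact h A hA _

end ModalCanon

open ModalCanon

/-! Let `A` lie in a variety `V` of finite achronal width, and let an equation of `V` fail in `A^σ`,
at an ultrafilter `w₀` under an assignment `e`. It is enough to copy this failure to the canonical
frame of a subalgebra `B` with at most `|M| + ω` elements, since `B` belongs to `V` and canonicity
in that power then puts `B^σ` into `V`. The type of a point of `A₊` is the set of subterms of the
equation that hold there; there are finitely many types.

A Löwenheim–Skolem argument (`MBAO.exists_reflects`) yields `B` together with a set `W` of
ultrafilters of `A`, containing `w₀`, that reflects finite lists of constraints: lists satisfiable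
over `B` are satisfiable in `A₊`, and by a point of `W` of any type that occurs. Each ultrafilter
`z` of `B` that is the trace of a point of `W`, or a successor over `B` of such a point, then
receives a type that fits it: inside every neighbourhood of `z` given by constraints, `W` has points
of this type whose diamond formulas over `B` are contained in those of `z`, and others whose diamond
formulas contain them. The two directions of inclusion drive the two halves of the truth lemma in
`MBAO.Reflects.exists_assignment`.

Finite width is what makes fitting types exist (`MBAO.Reflects.exists_fits`). The axioms `U_n` say
that the successors of a point contain no more than `n` pairwise incomparable points, when points
are compared by inclusion of their diamond formulas. If no point of type `τ` near `z` is below `z`,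
then bounded antichains let a smaller neighbourhood contain only points of type `τ` above `z`;
compactness gives these finitely many lower bounds in their closure, and excluding or using those
bounds expels the type `τ` altogether. All types cannot be expelled, as the neighbourhood is not
empty.

A logic is handled through the variety of its algebras: canonical frames of generated algebras are
generated subframes of canonical frames of the logic, and each of the latter is the canonical frame
of its algebra of definable sets. The concrete logics are treated algebraically, through
`axiomU_eval_eq_top`. -/

namespace ModalCanon

open Formula

/-! ### Ultrafilters of boolean algebras -/

namespace BAUltrafilter

variable {B : Type u} [BooleanAlgebra B]

theorem bot_notMem (μ : BAUltrafilter B) : ⊥ ∉ μ.1 := μ.2.1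

theorem compl_mem_iff (μ : BAUltrafilter B) {a : B} : aᶜ ∈ μ.1 ↔ a ∉ μ.1 := by
  refine ⟨fun h1 h2 => μ.2.1 ?_, fun h1 => (μ.2.2 a).resolve_left h1⟩
  simpa using Order.PFilter.inf_mem h2 h1

theorem inf_mem_iff (μ : BAUltrafilter B) {a b : B} : a ⊓ b ∈ μ.1 ↔ a ∈ μ.1 ∧ b ∈ μ.1 :=
  Order.PFilter.inf_mem_iff

theorem sup_mem_iff (μ : BAUltrafilter B) {a b : B} : a ⊔ b ∈ μ.1 ↔ a ∈ μ.1 ∨ b ∈ μ.1 := by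
  rw [← not_iff_not, ← compl_mem_iff, compl_sup, inf_mem_iff, compl_mem_iff, compl_mem_iff, not_or]

theorem mem_of_le (μ : BAUltrafilter B) {a b : B} (h : a ≤ b) (ha : a ∈ μ.1) : b ∈ μ.1 :=
  Order.PFilter.mem_of_le h ha

theorem finset_inf_mem (μ : BAUltrafilter B) (F : Finset B) (h : ∀ a ∈ F, a ∈ μ.1) :
    F.inf id ∈ μ.1 := by
  classical
  induction F using Finset.induction_on with
  | empty => simp
  | insert a s _ ih =>
    rw [Finset.inf_insert]
    exact (μ.inf_mem_iff).2 ⟨h a (by simp), ih fun b hb => h b (by simp [hb])⟩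

theorem ext {μ ν : BAUltrafilter B} (h : ∀ a, a ∈ μ.1 → a ∈ ν.1) : μ = ν := by
  apply Subtype.ext
  apply Order.PFilter.ext
  ext a
  refine ⟨h a, fun ha => ?_⟩
  by_contra hn
  exact (ν.compl_mem_iff).1 (h _ ((μ.compl_mem_iff).2 hn)) ha

/-- An ultrafilter presented by its underlying set. -/
theorem exists_mem_iff (U : Set B) (hbot : ⊥ ∉ U) (hinf : ∀ a ∈ U, ∀ b ∈ U, a ⊓ b ∈ U)
    (hle : ∀ a b, a ≤ b → a ∈ U → b ∈ U) (hc : ∀ a, a ∈ U ∨ aᶜ ∈ U) :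
    ∃ μ : BAUltrafilter B, ∀ a, a ∈ μ.1 ↔ a ∈ U := by
  have hU : Order.IsPFilter U := by
    refine Order.IsPFilter.of_def ?_ ?_ ?_
    · rcases hc ⊥ with h | h
      exacts [⟨_, h⟩, ⟨_, h⟩]
    · intro a ha b hb
      exact ⟨a ⊓ b, hinf a ha b hb, inf_le_left, inf_le_right⟩
    · intro a b hab ha
      exact hle a b hab ha
  exact ⟨⟨hU.toPFilter, hbot, hc⟩, fun a => Iff.rfl⟩

/-- A set with the finite intersection property extends to an ultrafilter. -/
theorem exists_of_finite_inf_ne_bot (S : Set B)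
    (h : ∀ F : Finset B, (∀ a ∈ F, a ∈ S) → F.inf id ≠ ⊥) :
    ∃ μ : BAUltrafilter B, ∀ a ∈ S, a ∈ μ.1 := by
  classical
  let G : Set B := {x | ∃ F : Finset B, (∀ a ∈ F, a ∈ S) ∧ F.inf id ≤ x}
  have hG : Order.IsPFilter G := by
    refine Order.IsPFilter.of_def ⟨⊤, ∅, by simp, by simp⟩ ?_ ?_
    · rintro a ⟨F, hF, ha⟩ b ⟨F', hF', hb⟩
      refine ⟨a ⊓ b, ⟨F ∪ F', ?_, ?_⟩, inf_le_left, inf_le_right⟩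
      · intro c hc
        rcases Finset.mem_union.1 hc with hc | hc
        exacts [hF c hc, hF' c hc]
      · rw [Finset.inf_union]
        exact inf_le_inf ha hb
    · rintro a b hab ⟨F, hF, ha⟩
      exact ⟨F, hF, ha.trans hab⟩
  have hd : Disjoint ((hG.toPFilter : Order.PFilter B) : Set B)
      ((Order.Ideal.principal ⊥ : Order.Ideal B) : Set B) := by
    rw [Set.disjoint_left]
    rintro x ⟨F, hF, hx⟩ hx'
    have : x ≤ ⊥ := hx'
    exact h F hF (le_bot_iff.1 (hx.trans this))
  obtain ⟨J, hJ, hIJ, hFJ⟩ := DistribLattice.prime_ideal_of_disjoint_filter_ideal hd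
  have hmem : ∀ x, x ∈ hJ.toPrimePair.F ↔ x ∉ J := by
    intro x
    have := hJ.toPrimePair.compl_I_eq_F
    rw [← SetLike.mem_coe, ← this]
    rfl
  refine ⟨⟨hJ.toPrimePair.F, ?_, ?_⟩, ?_⟩
  · rw [hmem]
    exact fun hn => hn J.bot_mem
  · intro b
    rw [hmem, hmem]
    by_contra hb
    push Not at hb
    have htop : (⊤ : B) ∈ J := by simpa using Order.Ideal.sup_mem hb.1 hb.2
    exact hJ.toIsProper.ne_univ (by
      ext x
      simpa using J.lower le_top htop)
  · intro a ha
    rw [hmem]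
    refine Set.disjoint_left.1 hFJ ?_
    exact ⟨{a}, by simpa using ha, by simp⟩

/-- A set all of whose finite parts lie in ultrafilters extends to an ultrafilter. -/
theorem exists_of_finite (S : Set B)
    (h : ∀ F : Finset B, (∀ a ∈ F, a ∈ S) → ∃ μ : BAUltrafilter B, ∀ a ∈ F, a ∈ μ.1) :
    ∃ μ : BAUltrafilter B, ∀ a ∈ S, a ∈ μ.1 := by
  refine exists_of_finite_inf_ne_bot S fun F hF hbot => ?_
  obtain ⟨μ, hμ⟩ := h F hF
  have hmem := μ.finset_inf_mem F hμ
  rw [hbot] at hmem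
  exact μ.bot_notMem hmem

end BAUltrafilter

/-! ### Orders of points, and finite sets of minimal points -/

section PointOrder

variable {B : Type u} [BooleanAlgebra B]

/-- `v` is below `w`, as far as the elements `E b` with `b ∈ T` are concerned. -/
def PointLE (E : B → B) (T : Set B) (v w : BAUltrafilter B) : Prop :=
  ∀ b ∈ T, E b ∈ v.1 → E b ∈ w.1

/-- The closure of a set of ultrafilters. -/
def pointClosure (P : Set (BAUltrafilter B)) : Set (BAUltrafilter B) :=
  {y | ∀ a ∈ y.1, ∃ v ∈ P, a ∈ v.1}

theorem subset_pointClosure (P : Set (BAUltrafilter B)) : P ⊆ pointClosure P :=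
  fun v hv _ ha => ⟨v, hv, ha⟩

theorem PointLE.trans {E : B → B} {T : Set B} {u v w : BAUltrafilter B} (h1 : PointLE E T u v)
    (h2 : PointLE E T v w) : PointLE E T u w := fun b hb h => h2 b hb (h1 b hb h)

theorem PointLE.mono {E : B → B} {T T' : Set B} {u v : BAUltrafilter B} (h : T ⊆ T')
    (h1 : PointLE E T' u v) : PointLE E T u v := fun b hb => h1 b (h hb)

/-- Compactness: being below all of `C` and lying in the closure of `P` both amount to containing
certain elements, and any finite number of these lie in a single member of the chain. -/
theorem exists_chain_lowerBound (E : B → B) (P C : Set (BAUltrafilter B))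
    (hCP : C ⊆ pointClosure P) (hne : C.Nonempty)
    (hC : ∀ v ∈ C, ∀ w ∈ C, PointLE E Set.univ v w ∨ PointLE E Set.univ w v) :
    ∃ y ∈ pointClosure P, ∀ c ∈ C, PointLE E Set.univ y c := by
  classical
  -- The first kind of element forces an ultrafilter below every member of `C`; the second kind,
  -- what is common to all of `P`, forces it into the closure.
  let S : Set B := {b | (∃ a, b = (E a)ᶜ ∧ ∃ c ∈ C, E a ∉ c.1) ∨ ∀ v ∈ P, b ∈ v.1}
  have key : ∀ F : Finset B, (∀ a ∈ F, a ∈ S) → ∃ μ ∈ C, ∀ a ∈ F, a ∈ μ.1 := by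
    intro F
    induction F using Finset.induction_on with
    | empty => intro _; exact ⟨hne.some, hne.some_mem, by simp⟩
    | insert b s _ ih =>
      intro hF
      obtain ⟨μ, hμC, hμ⟩ := ih fun a ha => hF a (by simp [ha])
      rcases hF b (by simp) with ⟨a, rfl, c, hc, hac⟩ | hb
      · have aux : ∀ ν ∈ C, PointLE E Set.univ ν c → (E a)ᶜ ∈ ν.1 := by
          intro ν _ hν
          rw [ν.compl_mem_iff]
          exact fun h => hac (hν a trivial h)
        rcases hC μ hμC c hc with h | h
        · refine ⟨μ, hμC, ?_⟩
          intro x hx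
          rcases Finset.mem_insert.1 hx with rfl | hx
          exacts [aux μ hμC h, hμ x hx]
        · refine ⟨c, hc, ?_⟩
          intro x hx
          rcases Finset.mem_insert.1 hx with rfl | hx
          · rw [c.compl_mem_iff]
            exact hac
          · rcases hF x (by simp [hx]) with ⟨a', rfl, _⟩ | hx'
            · rw [c.compl_mem_iff]
              exact fun h' => (μ.compl_mem_iff).1 (hμ _ hx) (h a' trivial h')
            · by_contra hn
              obtain ⟨v, hv, hxv⟩ := hCP hc _ ((c.compl_mem_iff).2 hn)
              exact (v.compl_mem_iff).1 hxv (hx' v hv)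
      · refine ⟨μ, hμC, ?_⟩
        intro x hx
        rcases Finset.mem_insert.1 hx with rfl | hx
        · by_contra hn
          obtain ⟨v, hv, hxv⟩ := hCP hμC _ ((μ.compl_mem_iff).2 hn)
          exact (v.compl_mem_iff).1 hxv (hb v hv)
        · exact hμ x hx
  obtain ⟨y, hy⟩ := BAUltrafilter.exists_of_finite S fun F hF =>
    (key F hF).imp fun _ h => h.2
  refine ⟨y, ?_, ?_⟩
  · intro a ha
    by_contra hn
    push Not at hn
    exact (y.compl_mem_iff).1 (hy aᶜ (Or.inr fun v hv => (v.compl_mem_iff).2 (hn v hv))) ha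
  · intro c hc a _ ha
    by_contra hn
    exact (y.compl_mem_iff).1 (hy _ (Or.inl ⟨a, rfl, c, hc, hn⟩)) ha

/-- Zorn's lemma for the reversed relation. The relation is only a preorder, so minimality means
that whatever is below `y` is also above it. -/
theorem exists_minimal_point (E : B → B) (P : Set (BAUltrafilter B)) (v : BAUltrafilter B)
    (hv : v ∈ pointClosure P) :
    ∃ y ∈ pointClosure P, PointLE E Set.univ y v ∧
      ∀ y' ∈ pointClosure P, PointLE E Set.univ y' y → PointLE E Set.univ y y' := by
  let X := {y : BAUltrafilter B // y ∈ pointClosure P ∧ PointLE E Set.univ y v}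
  let r : X → X → Prop := fun a b => PointLE E Set.univ b.1 a.1
  have hz : ∃ m : X, ∀ a, r m a → r a m := by
    refine exists_maximal_of_chains_bounded ?_ fun h1 h2 => PointLE.trans h2 h1
    intro c hc
    rcases c.eq_empty_or_nonempty with rfl | hne
    · exact ⟨⟨v, hv, fun _ _ h => h⟩, by simp⟩
    · obtain ⟨y, hy, hyc⟩ := exists_chain_lowerBound E P (Subtype.val '' c)
        (by rintro _ ⟨a, _, rfl⟩; exact a.2.1) (hne.image _) (by
          rintro _ ⟨a, ha, rfl⟩ _ ⟨b, hb, rfl⟩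
          by_cases hab : a = b
          · subst hab
            exact Or.inl fun _ _ h => h
          · exact (hc ha hb hab).symm)
      exact ⟨⟨y, hy, (hyc _ ⟨_, hne.some_mem, rfl⟩).trans hne.some.2.2⟩,
        fun a ha => hyc _ ⟨a, ha, rfl⟩⟩
  obtain ⟨m, hm⟩ := hz
  exact ⟨m.1, m.2.1, m.2.2, fun y' hy' h => hm ⟨y', hy', h.trans m.2.2⟩ h⟩

/-- A set of points of finite width, whose closure has the same width, lies above a finite set of
points of its closure. -/
theorem exists_finite_lowerBounds (E : B → B) (P : Set (BAUltrafilter B)) (n : ℕ)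
    (hw : ∀ s : Finset (BAUltrafilter B), (∀ v ∈ s, v ∈ pointClosure P) →
      (∀ v ∈ s, ∀ w ∈ s, v ≠ w → ¬ PointLE E Set.univ v w) → s.card ≤ n) :
    ∃ Y : Finset (BAUltrafilter B), (∀ y ∈ Y, y ∈ pointClosure P) ∧
      ∀ v ∈ P, ∃ y ∈ Y, PointLE E Set.univ y v := by
  classical
  -- Antichains of minimal points. One of largest size works: a minimal point below `v` that had no
  -- member of the antichain below it would be incomparable to all members and could be added.
  let Q : Finset (BAUltrafilter B) → Prop := fun s =>
    (∀ v ∈ s, v ∈ pointClosure P ∧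
      ∀ y' ∈ pointClosure P, PointLE E Set.univ y' v → PointLE E Set.univ v y') ∧
    ∀ v ∈ s, ∀ w ∈ s, v ≠ w → ¬ PointLE E Set.univ v w
  have hQ : ∀ s, Q s → s.card ≤ n := fun s hs => hw s (fun v hv => (hs.1 v hv).1) hs.2
  have hmax : ∃ s, Q s ∧ ∀ s', Q s' → s'.card ≤ s.card := by
    by_contra hcon
    push Not at hcon
    have : ∀ k, ∃ s, Q s ∧ k ≤ s.card := by
      intro k
      induction k with
      | zero => exact ⟨∅, ⟨by simp, by simp⟩, by simp⟩
      | succ k ih =>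
        obtain ⟨s, hs, hk⟩ := ih
        obtain ⟨s', hs', hlt⟩ := hcon s hs
        exact ⟨s', hs', by omega⟩
    obtain ⟨s, hs, hk⟩ := this (n + 1)
    have := hQ s hs
    omega
  obtain ⟨s, hs, hsmax⟩ := hmax
  refine ⟨s, fun y hy => (hs.1 y hy).1, fun v hv => ?_⟩
  obtain ⟨y, hy, hyv, hmin⟩ := exists_minimal_point E P v (subset_pointClosure P hv)
  by_contra hcon
  push Not at hcon
  have hlow : ∀ w ∈ s, ¬ PointLE E Set.univ w y := fun w hw h => hcon w hw (h.trans hyv)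
  have hlow' : ∀ w ∈ s, ¬ PointLE E Set.univ y w :=
    fun w hw h => hlow w hw ((hs.1 w hw).2 y hy h)
  have hys : y ∉ s := fun h => hlow y h fun _ _ h => h
  have := hsmax (insert y s) ⟨?_, ?_⟩
  · rw [Finset.card_insert_of_notMem hys] at this
    omega
  · intro w hw
    rcases Finset.mem_insert.1 hw with rfl | hw
    exacts [⟨hy, hmin⟩, hs.1 w hw]
  · intro w hw w' hw' hne
    rcases Finset.mem_insert.1 hw with h1 | h1 <;> rcases Finset.mem_insert.1 hw' with h2 | h2
    · exact absurd (h1.trans h2.symm) hne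
    · exact h1 ▸ hlow' _ h2
    · exact h2 ▸ hlow _ h1
    · exact hs.2 _ h1 _ h2 hne

end PointOrder

/-! ### Truth of formulas at the points of the canonical frame of an algebra -/

variable {M : Type u}

/-- The formula `φ` belongs to the ultrafilter `μ`, under the assignment `e`. -/
def MBAO.Holds (A : MBAO M) (e : ℕ → A.carrier) (μ : BAUltrafilter A.carrier)
    (φ : Formula M ℕ) : Prop := φ.toTerm.eval A e ∈ μ.1

section Holds

variable {A : MBAO M} {e : ℕ → A.carrier} {μ : BAUltrafilter A.carrier} {φ ψ : Formula M ℕ}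

theorem holds_neg : A.Holds e μ (neg φ) ↔ ¬ A.Holds e μ φ := μ.compl_mem_iff

theorem holds_or : A.Holds e μ (.or φ ψ) ↔ A.Holds e μ φ ∨ A.Holds e μ ψ := μ.sup_mem_iff

theorem holds_and : A.Holds e μ (.and φ ψ) ↔ A.Holds e μ φ ∧ A.Holds e μ ψ := by
  simp [Formula.and, holds_neg, holds_or]

theorem holds_imp : A.Holds e μ (imp φ ψ) ↔ (A.Holds e μ φ → A.Holds e μ ψ) := by
  simp [imp, holds_neg, holds_or, imp_iff_not_or]

theorem holds_top : A.Holds e μ .top := Order.PFilter.top_mem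

theorem not_holds_bot : ¬ A.Holds e μ bot := by
  simp [bot, holds_neg, holds_top]

theorem holds_bigOr {l : List (Formula M ℕ)} :
    A.Holds e μ (bigOr l) ↔ ∃ χ ∈ l, A.Holds e μ χ := by
  induction l with
  | nil => simp [bigOr, not_holds_bot]
  | cons χ l ih =>
    have : bigOr (χ :: l) = .or χ (bigOr l) := rfl
    simp [this, holds_or, ih]

theorem holds_bigAnd {l : List (Formula M ℕ)} :
    A.Holds e μ (bigAnd l) ↔ ∀ χ ∈ l, A.Holds e μ χ := by
  induction l with
  | nil => simp [bigAnd, holds_top]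
  | cons χ l ih =>
    have : bigAnd (χ :: l) = .and χ (bigAnd l) := rfl
    simp [this, holds_and, ih]

theorem holds_atom {i : ℕ} : A.Holds e μ (.atom i) ↔ e i ∈ μ.1 := Iff.rfl

theorem holds_dia {d : M} : A.Holds e μ (.dia d φ) ↔ A.op d (φ.toTerm.eval A e) ∈ μ.1 := Iff.rfl

theorem holds_box {d : M} : A.Holds e μ (box d φ) ↔ A.op d (φ.toTerm.eval A e)ᶜ ∉ μ.1 :=
  holds_neg

theorem holds_of_eq_top (h : φ.toTerm.eval A e = ⊤) : A.Holds e μ φ := by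
  rw [MBAO.Holds, h]
  exact Order.PFilter.top_mem

theorem eq_top_of_holds (h : ∀ μ, A.Holds e μ φ) : φ.toTerm.eval A e = ⊤ := by
  by_contra hn
  obtain ⟨μ, hμ⟩ := MBAO.exists_ultrafilter hn
  exact hμ (h μ)

end Holds

theorem BAUltrafilter.le_of_forall_mem {B : Type u} [BooleanAlgebra B] {a b : B}
    (h : ∀ μ : BAUltrafilter B, a ∈ μ.1 → b ∈ μ.1) : a ≤ b := by
  rw [← himp_eq_top_iff, himp_eq]
  by_contra hn
  obtain ⟨μ, hμ⟩ := MBAO.exists_ultrafilter hn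
  rw [μ.sup_mem_iff, μ.compl_mem_iff] at hμ
  tauto

theorem MBAO.op_mono (A : MBAO M) (d : M) {a b : A.carrier} (h : a ≤ b) : A.op d a ≤ A.op d b := by
  rw [← sup_eq_right.2 h, A.op_sup]
  exact le_sup_left

theorem MBAO.op_finset_sup (A : MBAO M) (d : M) {ι : Type*} (s : Finset ι) (f : ι → A.carrier) :
    A.op d (s.sup f) = s.sup fun i => A.op d (f i) := by
  classical
  induction s using Finset.induction_on with
  | empty => simp [A.op_bot]
  | insert a s _ ih => simp [Finset.sup_insert, A.op_sup, ih]

theorem BAUltrafilter.finset_sup_mem_iff {B : Type u} [BooleanAlgebra B] (μ : BAUltrafilter B)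
    {ι : Type*} (s : Finset ι) (f : ι → B) : s.sup f ∈ μ.1 ↔ ∃ i ∈ s, f i ∈ μ.1 := by
  classical
  induction s using Finset.induction_on with
  | empty => simp [μ.bot_notMem]
  | insert a s _ ih => simp [Finset.sup_insert, μ.sup_mem_iff, ih]

/-- An algebra satisfying the axioms `U_n` has achronal width at most `n` in its canonical frame. -/
theorem MBAO.card_le_of_pairwise_not_pointLE (A : MBAO M) (n : ℕ)
    (hA : ∀ φ ∈ axiomsU M n, ∀ e : ℕ → A.carrier, φ.toTerm.eval A e = ⊤) (d b : M)
    (x : BAUltrafilter A.carrier) (s : Finset (BAUltrafilter A.carrier))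
    (hs : ∀ v ∈ s, A.canonicalFrame.rel d x v)
    (h : ∀ v ∈ s, ∀ w ∈ s, v ≠ w → ¬ PointLE (A.op b) Set.univ v w) : s.card ≤ n := by
  classical
  by_contra hcard
  push Not at hcard
  obtain ⟨v, hvs, hinj⟩ : ∃ v : ℕ → BAUltrafilter A.carrier,
      (∀ i ∈ Finset.range (n + 1), v i ∈ s) ∧ Set.InjOn v (Finset.range (n + 1)) := by
    have hle : ((Finset.range (n + 1) : Finset ℕ) : Set ℕ).encard ≤ (↑s : Set (BAUltrafilter A.carrier)).encard := by
      rw [Set.encard_coe_eq_coe_finsetCard, Set.encard_coe_eq_coe_finsetCard, Finset.card_range]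
      exact_mod_cast hcard
    have : Nonempty (BAUltrafilter A.carrier) := ⟨x⟩
    obtain ⟨v, hv, hinj⟩ := (Finset.finite_toSet _).exists_injOn_of_encard_le hle
    exact ⟨v, fun i hi => hv hi, hinj⟩
  have hsep : ∀ i j, ∃ a : A.carrier, i ∈ Finset.range (n + 1) → j ∈ Finset.range (n + 1) → i ≠ j →
      A.op b a ∈ (v i).1 ∧ A.op b a ∉ (v j).1 := by
    intro i j
    by_cases hij : i ∈ Finset.range (n + 1) ∧ j ∈ Finset.range (n + 1) ∧ i ≠ j
    · have := h _ (hvs i hij.1) _ (hvs j hij.2.1) fun he =>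
        hij.2.2 (hinj (by simpa using hij.1) (by simpa using hij.2.1) he)
      simp only [PointLE, not_forall] at this
      obtain ⟨a, _, h1, h2⟩ := this
      exact ⟨a, fun _ _ _ => ⟨h1, h2⟩⟩
    · exact ⟨⊥, fun h1 h2 h3 => absurd ⟨h1, h2, h3⟩ hij⟩
  choose a ha using hsep
  -- The element `a j i` has its diamond in `v j` but not in `v i`. With this `q`, the point `v i`
  -- satisfies `■q_i` and no other `■q_j`, which refutes every disjunct of the axiom at `x`.
  let q : ℕ → A.carrier := fun i => (((Finset.range (n + 1)).filter (· ≠ i)).sup fun j => a j i)ᶜ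
  have hq1 : ∀ i ∈ Finset.range (n + 1), A.op b (q i)ᶜ ∉ (v i).1 := by
    intro i hi hmem
    simp only [q, compl_compl, MBAO.op_finset_sup, BAUltrafilter.finset_sup_mem_iff] at hmem
    obtain ⟨j, hj, hjm⟩ := hmem
    rw [Finset.mem_filter] at hj
    exact (ha j i hj.1 hi hj.2).2 hjm
  have hq2 : ∀ i ∈ Finset.range (n + 1), ∀ j ∈ Finset.range (n + 1), j ≠ i →
      A.op b (q j)ᶜ ∈ (v i).1 := by
    intro i hi j hj hji
    simp only [q, compl_compl, MBAO.op_finset_sup, BAUltrafilter.finset_sup_mem_iff]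
    exact ⟨i, by simpa [hji.symm] using hi, (ha i j hi hj hji.symm).1⟩
  have hU := holds_of_eq_top (μ := x) (hA _ ⟨d, b, rfl⟩ q)
  rw [holds_bigOr] at hU
  obtain ⟨χ, hχ, hx⟩ := hU
  obtain ⟨i, hi, rfl⟩ := List.mem_map.1 hχ
  rw [List.mem_range, ← Finset.mem_range] at hi
  rw [holds_box] at hx
  have hvi : A.Holds q (v i) (imp (box b (atom i)) (bigOr (((List.range (n + 1)).filter
      fun j => j ≠ i).map fun j => box b (atom j)))) := by
    by_contra hn
    exact hx (hs _ (hvs i hi) _ (((v i).compl_mem_iff).2 hn))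
  rw [holds_imp, holds_bigOr] at hvi
  obtain ⟨χ, hχ, hvχ⟩ := hvi (by rw [holds_box]; exact hq1 i hi)
  obtain ⟨j, hj, rfl⟩ := List.mem_map.1 hχ
  rw [List.mem_filter, List.mem_range, ← Finset.mem_range] at hj
  rw [holds_box] at hvχ
  exact hvχ (hq2 i hi j hj.1 (by simpa using hj.2))

/-! ### Closing off a small set under small-valued functions of finite lists -/

/-- Countably many rounds suffice because the entries of a list, being finitely many, all appear by
some finite stage; a set of size at most `κ` has at most `κ` finite lists, even with labels from
`I`. -/
theorem exists_small_closed {X I : Type u} (κ : Cardinal.{u}) (hκ : ℵ₀ ≤ κ) (hI : #I ≤ κ)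
    (f : List (I × X) → Set X) (hf : ∀ l, #(f l) ≤ κ) (S₀ : Set X) (h₀ : #S₀ ≤ κ) :
    ∃ S : Set X, S₀ ⊆ S ∧ #S ≤ κ ∧ ∀ l : List (I × X), (∀ p ∈ l, p.2 ∈ S) → f l ⊆ S := by
  classical
  let step : Set X → Set X := fun S =>
    S ∪ ⋃ l : List (I × S), f (l.map fun p => (p.1, (p.2 : X)))
  have hstep : ∀ S : Set X, #S ≤ κ → #(step S) ≤ κ := by
    intro S hS
    refine (mk_union_le _ _).trans (add_le_of_le hκ hS ?_)
    refine (mk_iUnion_le _).trans (mul_le_of_le hκ ?_ (ciSup_le' fun l => hf _))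
    refine (mk_list_le_max _).trans (max_le hκ ?_)
    rw [mk_prod, lift_id, lift_id]
    exact mul_le_of_le hκ hI hS
  let T : ℕ → Set X := fun k => step^[k] S₀
  have hT : ∀ k, T (k + 1) = step (T k) := fun k => Function.iterate_succ_apply' step k S₀
  have hmono : Monotone T := monotone_nat_of_le_succ fun k => by
    rw [hT]
    exact Set.subset_union_left
  refine ⟨⋃ k, T k, Set.subset_iUnion T 0, ?_, ?_⟩
  · have hTk : ∀ k, #(T k) ≤ κ := by
      intro k
      induction k with
      | zero => exact h₀
      | succ k ih => rw [hT]; exact hstep _ ih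
    have := mk_iUnion_le_lift.{u, 0} T
    refine (by simpa using this : #(⋃ k, T k) ≤ ℵ₀ * ⨆ k, #(T k)).trans ?_
    exact mul_le_of_le hκ hκ (ciSup_le' hTk)
  · intro l hl
    have hk : ∃ k, ∀ p ∈ l, p.2 ∈ T k := by
      induction l with
      | nil => exact ⟨0, by simp⟩
      | cons p l ih =>
        obtain ⟨k, hk⟩ := ih fun p' hp' => hl p' (by simp [hp'])
        obtain ⟨k', hk'⟩ := Set.mem_iUnion.1 (hl p (by simp))
        refine ⟨max k k', fun p' hp' => ?_⟩
        rcases List.mem_cons.1 hp' with rfl | hp'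
        exacts [hmono (le_max_right _ _) hk', hmono (le_max_left _ _) (hk p' hp')]
    obtain ⟨k, hk⟩ := hk
    refine Set.Subset.trans ?_ (Set.subset_iUnion T (k + 1))
    rw [hT]
    refine Set.Subset.trans ?_ Set.subset_union_right
    have : f l = f ((l.attach.map fun p => (p.1.1, (⟨p.1.2, hk p.1 p.2⟩ : T k))).map
        fun p => (p.1, (p.2 : X))) := by
      rw [List.map_map]
      exact congrArg f (List.attach_map_subtype_val l).symm
    rw [this]
    exact Set.subset_iUnion (fun l : List (I × T k) => f (l.map fun p => (p.1, (p.2 : X)))) _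

/-! ### Constraints on points -/

/-- The operation with respect to which points are ordered: a diamond or its complement. -/
def MBAO.ordOp (A : MBAO M) : M × Bool → A.carrier → A.carrier
  | (d, true), a => A.op d a
  | (d, false), a => (A.op d a)ᶜ

/-- The kinds of constraints on a point: to contain a given element, or to be equal to, a successor
of, or below a given point. -/
inductive CKind (M : Type u) : Type u
  | const : CKind M
  | eq : CKind M
  | succ : M → CKind M
  | le : M × Bool → CKind M

/-- The parameters of constraints: elements and points. -/
abbrev MBAO.Param (A : MBAO M) : Type u := A.carrier ⊕ BAUltrafilter A.carrier

/-- The elements that have to belong to an ultrafilter meeting a constraint, as far as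
elements of `B` are concerned. -/
def MBAO.constraintSet (A : MBAO M) (B : Set A.carrier) : CKind M × A.Param → Set A.carrier
  | (.const, .inl b) => {b}
  | (.eq, .inr y) => {a | a ∈ B ∧ a ∈ y.1}
  | (.succ d, .inr y) => {c | ∃ a ∈ B, c = aᶜ ∧ A.op d a ∉ y.1}
  | (.le i, .inr y) => {c | ∃ a ∈ B, c = (A.ordOp i a)ᶜ ∧ A.ordOp i a ∉ y.1}
  | _ => ∅

/-- The points that meet all constraints of a list, as far as elements of `B` are concerned. -/
def MBAO.points (A : MBAO M) (B : Set A.carrier) (K : List (CKind M × A.Param)) :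
    Set (BAUltrafilter A.carrier) :=
  {v | ∀ p ∈ K, ∀ c ∈ A.constraintSet B p, c ∈ v.1}

section Constraints

variable {A : MBAO M} {B B' : Set A.carrier}

theorem constraintSet_mono (h : B ⊆ B') (p : CKind M × A.Param) :
    A.constraintSet B p ⊆ A.constraintSet B' p := by
  rcases p with ⟨k, x⟩
  cases k <;> cases x <;> intro c hc
  · exact hc
  · exact hc
  · exact hc
  · exact ⟨h hc.1, hc.2⟩
  · exact hc
  · obtain ⟨a, ha, h1⟩ := hc
    exact ⟨a, h ha, h1⟩
  · exact hc
  · obtain ⟨a, ha, h1⟩ := hc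
    exact ⟨a, h ha, h1⟩

/-- Each requirement is caused by one element; this finitary character is what compactness needs. -/
theorem exists_mem_constraintSet_singleton {p : CKind M × A.Param} {c : A.carrier}
    (h : c ∈ A.constraintSet Set.univ p) : ∃ a, c ∈ A.constraintSet {a} p := by
  rcases p with ⟨k, x⟩
  cases k <;> cases x
  · exact ⟨⊥, h⟩
  · exact ⟨⊥, h⟩
  · exact ⟨⊥, h⟩
  · exact ⟨c, rfl, h.2⟩
  · exact ⟨⊥, h⟩
  · obtain ⟨a, -, h1⟩ := h
    exact ⟨a, a, rfl, h1⟩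
  · exact ⟨⊥, h⟩
  · obtain ⟨a, -, h1⟩ := h
    exact ⟨a, a, rfl, h1⟩

theorem mem_points_append {K K' : List (CKind M × A.Param)} {v : BAUltrafilter A.carrier} :
    v ∈ A.points B (K ++ K') ↔ v ∈ A.points B K ∧ v ∈ A.points B K' := by
  simp only [MBAO.points, List.mem_append, Set.mem_ofPred_eq]
  exact ⟨fun h => ⟨fun p hp => h p (Or.inl hp), fun p hp => h p (Or.inr hp)⟩,
    fun h p hp => hp.elim (h.1 p) (h.2 p)⟩

theorem mem_points_nil {v : BAUltrafilter A.carrier} : v ∈ A.points B [] :=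
  fun p hp => absurd hp (by simp)

theorem mem_points_singleton {p : CKind M × A.Param} {v : BAUltrafilter A.carrier} :
    v ∈ A.points B [p] ↔ ∀ c ∈ A.constraintSet B p, c ∈ v.1 := by
  simp [MBAO.points]

theorem mem_points_const {b : A.carrier} {v : BAUltrafilter A.carrier} :
    v ∈ A.points B [(.const, .inl b)] ↔ b ∈ v.1 := by
  simp [mem_points_singleton, MBAO.constraintSet]

theorem mem_points_eq {y v : BAUltrafilter A.carrier} :
    v ∈ A.points B [(.eq, .inr y)] ↔ ∀ a ∈ B, a ∈ y.1 → a ∈ v.1 := by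
  simp [mem_points_singleton, MBAO.constraintSet]

theorem mem_points_succ {d : M} {y v : BAUltrafilter A.carrier} :
    v ∈ A.points B [(.succ d, .inr y)] ↔ ∀ a ∈ B, a ∈ v.1 → A.op d a ∈ y.1 := by
  rw [mem_points_singleton]
  constructor
  · intro h a ha hav
    by_contra hn
    exact (v.compl_mem_iff).1 (h _ ⟨a, ha, rfl, hn⟩) hav
  · rintro h _ ⟨a, ha, rfl, hn⟩
    exact (v.compl_mem_iff).2 fun hav => hn (h a ha hav)

theorem mem_points_le {i : M × Bool} {y v : BAUltrafilter A.carrier} :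
    v ∈ A.points B [(.le i, .inr y)] ↔ PointLE (A.ordOp i) B v y := by
  rw [mem_points_singleton]
  constructor
  · intro h a ha hav
    by_contra hn
    exact (v.compl_mem_iff).1 (h _ ⟨a, ha, rfl, hn⟩) hav
  · rintro h _ ⟨a, ha, rfl, hn⟩
    exact (v.compl_mem_iff).2 fun hav => hn (h a ha hav)

/-- If no point meets the constraints, then finitely many elements witness this. -/
theorem exists_finite_inconsistent {K : List (CKind M × A.Param)}
    (h : A.points Set.univ K = ∅) :
    ∃ G : Finset A.carrier, A.points G K = ∅ := by
  classical
  let S : Set A.carrier := {c | ∃ p ∈ K, c ∈ A.constraintSet Set.univ p}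
  obtain ⟨F, hF, hbot⟩ : ∃ F : Finset A.carrier, (∀ a ∈ F, a ∈ S) ∧ F.inf id = ⊥ := by
    by_contra hn
    push Not at hn
    obtain ⟨μ, hμ⟩ := BAUltrafilter.exists_of_finite_inf_ne_bot S hn
    have : μ ∈ A.points Set.univ K := fun p hp c hc => hμ c ⟨p, hp, hc⟩
    simp [h] at this
  have hg : ∀ c : A.carrier, ∃ a, c ∈ F → ∃ p ∈ K, c ∈ A.constraintSet {a} p := by
    intro c
    by_cases hc : c ∈ F
    · obtain ⟨p, hp, hcp⟩ := hF c hc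
      obtain ⟨a, ha⟩ := exists_mem_constraintSet_singleton hcp
      exact ⟨a, fun _ => ⟨p, hp, ha⟩⟩
    · exact ⟨⊥, fun h => absurd h hc⟩
  choose g hg using hg
  refine ⟨F.image g, Set.eq_empty_iff_forall_notMem.2 fun v hv => v.bot_notMem ?_⟩
  have : F.inf id ∈ v.1 := ?_
  · rwa [hbot] at this
  refine v.finset_inf_mem F fun c hc => ?_
  obtain ⟨p, hp, hcp⟩ := hg c hc
  exact hv p hp c (constraintSet_mono (by simpa using ⟨c, hc, rfl⟩) p hcp)

theorem points_anti (h : B ⊆ B') (K : List (CKind M × A.Param)) :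
    A.points B' K ⊆ A.points B K :=
  fun _ hv p hp c hc => hv p hp c (constraintSet_mono h p hc)

end Constraints

theorem mk_cKind_le (κ : Cardinal.{u}) (hκ : ℵ₀ ≤ κ) (hM : #M ≤ κ) : #(CKind M) ≤ κ := by
  let f : Option (Option M) ⊕ (M × Bool) → CKind M
    | .inl none => .const
    | .inl (some none) => .eq
    | .inl (some (some d)) => .succ d
    | .inr i => .le i
  have hf : Function.Surjective f := by
    rintro (_ | _ | d | i)
    exacts [⟨.inl none, rfl⟩, ⟨.inl (some none), rfl⟩, ⟨.inl (some (some d)), rfl⟩, ⟨.inr i, rfl⟩]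
  refine (mk_le_of_surjective hf).trans ?_
  have h1 : (1 : Cardinal.{u}) ≤ κ := one_le_aleph0.trans hκ
  have hB : #Bool ≤ ℵ₀ := mk_le_aleph0
  simp only [mk_sum, mk_option, mk_prod, lift_id, lift_uzero]
  refine add_le_of_le hκ (add_le_of_le hκ (add_le_of_le hκ hM h1) h1) (mul_le_of_le hκ hM ?_)
  refine (lift_le.2 hB).trans ?_
  simpa using hκ

/-- The parameters of the constraints in `K` are elements of `B` and points of `W`. -/
def MBAO.Over (A : MBAO M) (B : Set A.carrier) (W : Set (BAUltrafilter A.carrier))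
    (K : List (CKind M × A.Param)) : Prop :=
  ∀ p ∈ K, Sum.elim (· ∈ B) (· ∈ W) p.2

/-- A set of elements and points that is closed enough to reflect the types `t` of the points. -/
structure MBAO.Reflects (A : MBAO M) {T : Type u} (t : BAUltrafilter A.carrier → T)
    (B : Set A.carrier) (W : Set (BAUltrafilter A.carrier)) : Prop where
  sub : A.IsSubalgebra B
  consistent : ∀ K : List (CKind M × A.Param), A.Over B W K →
    ∀ z ∈ A.points B K, (A.points Set.univ K).Nonempty
  exists_mem : ∀ K : List (CKind M × A.Param), A.Over B W K →
    ∀ v ∈ A.points Set.univ K, ∃ w ∈ W, w ∈ A.points Set.univ K ∧ t w = t v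
  bounds : ∀ K : List (CKind M × A.Param), A.Over B W K →
    ∀ (τ : T) (i : M × Bool),
      (∃ Y : Finset (BAUltrafilter A.carrier),
        (∀ y ∈ Y, y ∈ pointClosure {v | v ∈ A.points Set.univ K ∧ t v = τ}) ∧
        ∀ v ∈ A.points Set.univ K, t v = τ → ∃ y ∈ Y, PointLE (A.ordOp i) Set.univ y v) →
      ∃ Y : Finset (BAUltrafilter A.carrier), (∀ y ∈ Y, y ∈ W) ∧
        (∀ y ∈ Y, y ∈ pointClosure {v | v ∈ A.points Set.univ K ∧ t v = τ}) ∧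
        ∀ v ∈ A.points Set.univ K, t v = τ → ∃ y ∈ Y, PointLE (A.ordOp i) Set.univ y v

/-- A Löwenheim–Skolem closure: for each finite list, each of the finitely many types and each of
the at most `κ` orders, every clause asks for finitely many witnesses only. Consistency is such a
clause because an unsatisfiable list is already refuted by finitely many elements, which are put
into `B`. -/
theorem MBAO.exists_reflects (A : MBAO M) {T : Type u} [Finite T]
    (t : BAUltrafilter A.carrier → T) (κ : Cardinal.{u}) (hκ : ℵ₀ ≤ κ) (hM : #M ≤ κ)
    (w₀ : BAUltrafilter A.carrier) :
    ∃ (B : Set A.carrier) (W : Set (BAUltrafilter A.carrier)),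
      #B ≤ κ ∧ w₀ ∈ W ∧ A.Reflects t B W := by
  classical
  have hC : ∀ K : List (CKind M × A.Param), ∃ G : Finset A.carrier,
      A.points Set.univ K = ∅ → A.points G K = ∅ := by
    intro K
    by_cases h : A.points Set.univ K = ∅
    · exact (exists_finite_inconsistent h).imp fun G hG _ => hG
    · exact ⟨∅, fun h' => absurd h' h⟩
  have hD : ∀ (K : List (CKind M × A.Param)) (τ : T), ∃ D : Finset (BAUltrafilter A.carrier),
      ∀ v ∈ A.points Set.univ K, t v = τ → ∃ w ∈ D, w ∈ A.points Set.univ K ∧ t w = τ := by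
    intro K τ
    by_cases h : ∃ v ∈ A.points Set.univ K, t v = τ
    · obtain ⟨v, hv⟩ := h
      exact ⟨{v}, fun _ _ _ => ⟨v, by simp, hv⟩⟩
    · exact ⟨∅, fun v h1 h2 => absurd ⟨v, h1, h2⟩ h⟩
  let good : List (CKind M × A.Param) → T → M × Bool → Finset (BAUltrafilter A.carrier) → Prop :=
    fun K τ i Y => (∀ y ∈ Y, y ∈ pointClosure {v | v ∈ A.points Set.univ K ∧ t v = τ}) ∧
        ∀ v ∈ A.points Set.univ K, t v = τ → ∃ y ∈ Y, PointLE (A.ordOp i) Set.univ y v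
  have hE : ∀ (K : List (CKind M × A.Param)) (τ : T) (i : M × Bool),
      ∃ Y : Finset (BAUltrafilter A.carrier), (∃ Y', good K τ i Y') → good K τ i Y := by
    intro K τ i
    by_cases h : ∃ Y', good K τ i Y'
    · exact h.imp fun _ hY _ => hY
    · exact ⟨∅, fun h' => absurd h' h⟩
  choose C hC using hC
  choose D hD using hD
  choose E hE using hE
  -- Reads the element in a list entry; the default `⊥` for points and missing entries is harmless,
  -- since it only adds elements to the closure.
  let el : Option (CKind M × A.Param) → A.carrier
    | some (_, .inl a) => a
    | _ => ⊥
  -- One function serves both purposes: its first two parts apply the operations to the leading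
  -- entries of the list, so that `B` becomes a subalgebra, and the others add the chosen witnesses.
  let f : List (CKind M × A.Param) → Set A.Param := fun K =>
    {.inl ⊤, .inl (el K[0]?)ᶜ, .inl (el K[0]? ⊔ el K[1]?)} ∪
    (Set.range fun d => .inl (A.op d (el K[0]?))) ∪
    ((C K).image .inl : Finset A.Param) ∪
    (⋃ τ, ((D K τ).image .inr : Finset A.Param)) ∪
    ⋃ p : T × (M × Bool), ((E K p.1 p.2).image .inr : Finset A.Param)
  have hfin : ∀ s : Finset A.Param, #(s : Set A.Param) ≤ κ := fun s =>
    (mk_le_aleph0_iff.2 (s.countable_toSet.to_subtype)).trans hκ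
  have hT : #T ≤ κ := mk_le_aleph0.trans hκ
  have hB : lift.{u} #Bool ≤ κ := by
    refine (lift_le.2 (mk_le_aleph0 (α := Bool))).trans ?_
    simpa using hκ
  have hf : ∀ K, #(f K) ≤ κ := by
    intro K
    refine (mk_union_le _ _).trans (add_le_of_le hκ ?_ ?_)
    · refine (mk_union_le _ _).trans (add_le_of_le hκ ?_ ?_)
      · refine (mk_union_le _ _).trans (add_le_of_le hκ ?_ (hfin _))
        refine (mk_union_le _ _).trans (add_le_of_le hκ ?_ (mk_range_le.trans hM))
        exact (mk_le_aleph0_iff.2 (Set.Finite.countable (by simp)).to_subtype).trans hκ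
      · exact (mk_iUnion_le _).trans (mul_le_of_le hκ hT (ciSup_le' fun _ => hfin _))
    · refine (mk_iUnion_le _).trans (mul_le_of_le hκ ?_ (ciSup_le' fun _ => hfin _))
      rw [mk_prod, mk_prod, lift_id, lift_id, lift_uzero]
      exact mul_le_of_le hκ hT (mul_le_of_le hκ hM hB)
  obtain ⟨S, hS₀, hSκ, hS⟩ := exists_small_closed κ hκ (mk_cKind_le κ hκ hM) f hf {.inr w₀}
    (by simpa using one_le_aleph0.trans hκ)
  have hover : ∀ K : List (CKind M × A.Param),
      A.Over {a | Sum.inl a ∈ S} {w | Sum.inr w ∈ S} K → f K ⊆ S := by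
    intro K hK
    refine hS K fun p hp => ?_
    have := hK p hp
    rcases p with ⟨k, a | w⟩
    exacts [this, this]
  refine ⟨{a | .inl a ∈ S}, {w | .inr w ∈ S}, ?_, hS₀ rfl, ?_, ?_, ?_, ?_⟩
  · refine (mk_le_of_injective (f := fun a : {a | Sum.inl a ∈ S} => (⟨.inl a.1, a.2⟩ : S))
      fun a b h => ?_).trans hSκ
    simpa [Subtype.ext_iff] using h
  · have hnil : f [] ⊆ S := hS [] (by simp)
    have htop : Sum.inl ⊤ ∈ S := hnil (by simp [f])
    have hcompl : ∀ a, Sum.inl a ∈ S → Sum.inl aᶜ ∈ S := fun a ha =>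
      hS [(.const, .inl a)] (by simpa using ha) (by simp [f, el])
    refine ⟨by simpa using hcompl _ htop, htop, hcompl, ?_, ?_⟩
    · intro a ha b hb
      refine hS [(.const, .inl a), (.const, .inl b)] ?_ (by simp [f, el])
      rintro p hp
      simp only [List.mem_cons, List.not_mem_nil, or_false] at hp
      rcases hp with rfl | rfl
      exacts [ha, hb]
    · intro d a ha
      exact hS [(.const, .inl a)] (by simpa using ha) (by simp [f, el])
  · intro K hK z hz
    by_contra hn
    rw [Set.not_nonempty_iff_eq_empty] at hn
    have h1 : (C K : Set A.carrier) ⊆ {a | Sum.inl a ∈ S} := fun a ha =>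
      hover K hK (by simp only [f, Set.mem_union]; left; left; right; simpa using ha)
    have := points_anti h1 K hz
    simp [hC K hn] at this
  · intro K hK v hv
    obtain ⟨w, hw, h1, h2⟩ := hD K (t v) v hv rfl
    refine ⟨w, hover K hK ?_, h1, h2⟩
    simp only [f, Set.mem_union]
    left; right
    exact Set.mem_iUnion.2 ⟨t v, by simpa using hw⟩
  · intro K hK τ i h
    refine ⟨E K τ i, fun y hy => hover K hK ?_, hE K τ i h⟩
    simp only [f, Set.mem_union]
    right
    exact Set.mem_iUnion.2 ⟨(τ, i), by simpa using hy⟩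

/-! ### Types that fit a point of the canonical frame of a subalgebra -/

section Fits

variable {A : MBAO M} {B : Set A.carrier} {W : Set (BAUltrafilter A.carrier)}

theorem MBAO.IsSubalgebra.ordOp_mem (hB : A.IsSubalgebra B) (i : M × Bool) {a : A.carrier}
    (ha : a ∈ B) : A.ordOp i a ∈ B := by
  rcases i with ⟨d, _ | _⟩
  exacts [hB.compl_mem _ (hB.op_mem d a ha), hB.op_mem d a ha]

/-- Complementing the diamond reverses the order, so a statement proved for all `M × Bool` covers
lower and upper bounds at once. -/
theorem pointLE_ordOp_false {d : M} {v w : BAUltrafilter A.carrier} :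
    PointLE (A.ordOp (d, false)) B v w ↔ PointLE (A.ordOp (d, true)) B w v := by
  simp only [PointLE, MBAO.ordOp, BAUltrafilter.compl_mem_iff, not_imp_not]

/-- All sets of pairwise incomparable successors of a point have at most `n` elements. -/
def MBAO.HasWidth (A : MBAO M) (n : ℕ) : Prop :=
  ∀ (d : M) (i : M × Bool) (x : BAUltrafilter A.carrier) (s : Finset (BAUltrafilter A.carrier)),
    (∀ v ∈ s, ∀ a, a ∈ v.1 → A.op d a ∈ x.1) →
    (∀ v ∈ s, ∀ w ∈ s, v ≠ w → ¬ PointLE (A.ordOp i) Set.univ v w) → s.card ≤ n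

/-- Reversing the order does not change which sets are antichains, so the bound for diamonds carries
over to their complements. -/
theorem MBAO.hasWidth_of_axiomsU (n : ℕ)
    (hA : ∀ φ ∈ axiomsU M n, ∀ e : ℕ → A.carrier, φ.toTerm.eval A e = ⊤) : A.HasWidth n := by
  rintro d ⟨b, _ | _⟩ x s hs h
  · refine A.card_le_of_pairwise_not_pointLE n hA d b x s hs fun v hv w hw hne hvw => ?_
    exact h w hw v hv hne.symm (pointLE_ordOp_false.2 hvw)
  · exact A.card_le_of_pairwise_not_pointLE n hA d b x s hs h

/-- A list of constraints over `B` and `W` that `z` meets, as far as elements of `B` go. -/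
def MBAO.Meets (A : MBAO M) (B : Set A.carrier) (W : Set (BAUltrafilter A.carrier))
    (z : BAUltrafilter A.carrier) (K : List (CKind M × A.Param)) : Prop :=
  A.Over B W K ∧ z ∈ A.points B K

variable {z : BAUltrafilter A.carrier}

theorem MBAO.Meets.nil : A.Meets B W z [] := ⟨fun _ h => absurd h (by simp), mem_points_nil⟩

theorem MBAO.Meets.append {K K' : List (CKind M × A.Param)} (h : A.Meets B W z K)
    (h' : A.Meets B W z K') : A.Meets B W z (K ++ K') :=
  ⟨fun p hp => (List.mem_append.1 hp).elim (h.1 p) (h'.1 p), mem_points_append.2 ⟨h.2, h'.2⟩⟩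

theorem MBAO.Over.append {K K' : List (CKind M × A.Param)} (h : A.Over B W K)
    (h' : A.Over B W K') : A.Over B W (K ++ K') :=
  fun p hp => (List.mem_append.1 hp).elim (h p) (h' p)

theorem MBAO.Over.const {b : A.carrier} (hb : b ∈ B) : A.Over B W [(.const, .inl b)] := by
  intro p hp
  obtain rfl : p = _ := by simpa using hp
  exact hb

theorem MBAO.Over.point {k : CKind M} {y : BAUltrafilter A.carrier} (hy : y ∈ W) :
    A.Over B W [(k, .inr y)] := by
  intro p hp
  obtain rfl : p = _ := by simpa using hp
  exact hy

theorem MBAO.Meets.const {b : A.carrier} (hb : b ∈ B) (hz : b ∈ z.1) :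
    A.Meets B W z [(.const, .inl b)] := ⟨.const hb, mem_points_const.2 hz⟩

theorem MBAO.IsSubalgebra.exists_meets_not_ge (hB : A.IsSubalgebra B) (i : M × Bool)
    {y : BAUltrafilter A.carrier} (h : ¬ PointLE (A.ordOp i) B y z) :
    ∃ L, A.Meets B W z L ∧ ∀ w ∈ A.points Set.univ L, ¬ PointLE (A.ordOp i) B y w := by
  simp only [PointLE, not_forall] at h
  obtain ⟨b, hb, h1, h2⟩ := h
  refine ⟨_, .const (hB.compl_mem _ (hB.ordOp_mem i hb)) ((z.compl_mem_iff).2 h2), ?_⟩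
  intro w hw hle
  exact (w.compl_mem_iff).1 (mem_points_const.1 hw) (hle b hb h1)

theorem MBAO.IsSubalgebra.exists_meets_not_le (hB : A.IsSubalgebra B) (i : M × Bool)
    {y : BAUltrafilter A.carrier} (h : ¬ PointLE (A.ordOp i) B z y) :
    ∃ L, A.Meets B W z L ∧ ∀ w ∈ A.points Set.univ L, ¬ PointLE (A.ordOp i) B w y := by
  simp only [PointLE, not_forall] at h
  obtain ⟨b, hb, h1, h2⟩ := h
  exact ⟨_, .const (hB.ordOp_mem i hb) h1, fun w hw hle => h2 (hle b hb (mem_points_const.1 hw))⟩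

/-- Neighbourhoods of `z` are closed under finite intersection: the lists are concatenated. -/
theorem exists_meets_forall {ι : Type*} (R : ι → BAUltrafilter A.carrier → Prop) (s : Finset ι)
    (h : ∀ y ∈ s, ∃ L, A.Meets B W z L ∧ ∀ w ∈ A.points Set.univ L, R y w) :
    ∃ L, A.Meets B W z L ∧ ∀ w ∈ A.points Set.univ L, ∀ y ∈ s, R y w := by
  classical
  induction s using Finset.induction_on with
  | empty => exact ⟨[], .nil, by simp⟩
  | insert a s _ ih =>
    obtain ⟨L, hL, h1⟩ := ih fun y hy => h y (by simp [hy])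
    obtain ⟨L', hL', h2⟩ := h a (by simp)
    refine ⟨L ++ L', hL.append hL', fun w hw y hy => ?_⟩
    rw [mem_points_append] at hw
    rcases Finset.mem_insert.1 hy with rfl | hy
    exacts [h2 w hw.2, h1 w hw.1 y hy]

variable {T : Type u} {t : BAUltrafilter A.carrier → T}

/-- If no point of type `τ` near `z` is below `z`, then all of them can be taken above `z`. -/
theorem MBAO.Reflects.exists_meets_forall_ge (hR : A.Reflects t B W) {n : ℕ} (hn : A.HasWidth n)
    {K : List (CKind M × A.Param)} {d : M} {x : BAUltrafilter A.carrier}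
    (hx : ∀ v ∈ A.points Set.univ K, ∀ a, a ∈ v.1 → A.op d a ∈ x.1) (τ : T) (i : M × Bool)
    (h : ∀ w ∈ W, w ∈ A.points Set.univ K → t w = τ → ¬ PointLE (A.ordOp i) B w z) :
    ∃ L, A.Meets B W z L ∧ ∀ w ∈ W, w ∈ A.points Set.univ (K ++ L) → t w = τ →
      PointLE (A.ordOp i) B z w := by
  classical
  by_contra hcon
  push Not at hcon
  -- If no `L` works, antichains of points incomparable to `z` grow without end: a list met by `z`
  -- keeps new points incomparable to those already chosen, and its failure supplies a new point of
  -- type `τ` not above `z`, which is not below `z` by `h`. Incomparability over `B` persists over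
  -- all of `A`, against the width.
  have key : ∀ m : ℕ, ∃ s : Finset (BAUltrafilter A.carrier), s.card = m ∧
      (∀ v ∈ s, v ∈ A.points Set.univ K ∧ ¬ PointLE (A.ordOp i) B v z ∧
        ¬ PointLE (A.ordOp i) B z v) ∧
      ∀ v ∈ s, ∀ w ∈ s, v ≠ w → ¬ PointLE (A.ordOp i) B v w := by
    intro m
    induction m with
    | zero => exact ⟨∅, by simp⟩
    | succ m ih =>
      obtain ⟨s, hs, h1, h2⟩ := ih
      obtain ⟨L, hL, hLs⟩ := exists_meets_forall
        (fun y w => ¬ PointLE (A.ordOp i) B y w ∧ ¬ PointLE (A.ordOp i) B w y) s fun y hy => by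
          obtain ⟨L, hL, h3⟩ := hR.sub.exists_meets_not_ge (W := W) i (h1 y hy).2.1
          obtain ⟨L', hL', h4⟩ := hR.sub.exists_meets_not_le (W := W) i (h1 y hy).2.2
          exact ⟨L ++ L', hL.append hL', fun w hw =>
            ⟨h3 w (mem_points_append.1 hw).1, h4 w (mem_points_append.1 hw).2⟩⟩
      obtain ⟨w, hwW, hw, hwt, hwz⟩ := hcon L hL
      rw [mem_points_append] at hw
      have hws : w ∉ s := fun hmem => (hLs w hw.2 w hmem).1 fun _ _ h => h
      refine ⟨insert w s, by rw [Finset.card_insert_of_notMem hws, hs], ?_, ?_⟩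
      · intro v hv
        rcases Finset.mem_insert.1 hv with rfl | hv
        exacts [⟨hw.1, h v hwW hw.1 hwt, hwz⟩, h1 v hv]
      · intro v hv v' hv' hne
        rcases Finset.mem_insert.1 hv with e1 | h3 <;> rcases Finset.mem_insert.1 hv' with e2 | h4
        · exact absurd (e1.trans e2.symm) hne
        · exact e1 ▸ (hLs w hw.2 v' h4).2
        · exact e2 ▸ (hLs w hw.2 v h3).1
        · exact h2 v h3 v' h4 hne
  obtain ⟨s, hs, h1, h2⟩ := key (n + 1)
  have := hn d i x s (fun v hv => hx v (h1 v hv).1) fun v hv w hw hne hle =>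
    h2 v hv w hw hne (hle.mono (Set.subset_univ B))
  omega

/-- If no point of type `τ` near `z` is below `z`, then there are no points of type `τ` near `z`. -/
theorem MBAO.Reflects.exists_meets_type_ne (hR : A.Reflects t B W) {n : ℕ} (hn : A.HasWidth n)
    {K : List (CKind M × A.Param)} (hK : A.Meets B W z K) {d : M} {x : BAUltrafilter A.carrier}
    (hx : ∀ v ∈ A.points Set.univ K, ∀ a, a ∈ v.1 → A.op d a ∈ x.1) (τ : T) (i : M × Bool)
    (h : ∀ w ∈ W, w ∈ A.points Set.univ K → t w = τ → ¬ PointLE (A.ordOp i) B w z) :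
    ∃ L, A.Meets B W z L ∧ ∀ w ∈ W, w ∈ A.points Set.univ L → t w ≠ τ := by
  obtain ⟨L, hL, hge⟩ := hR.exists_meets_forall_ge hn hx τ i h
  have hKL := hK.append hL
  -- The successors of `x` form a closed set, so the width bound also applies to the closure of the
  -- points considered; the lower bounds can then be taken in `W`.
  obtain ⟨Y, hYW, hYcl, hY⟩ := hR.bounds (K ++ L) hKL.1 τ i (by
    obtain ⟨Y, h1, h2⟩ := exists_finite_lowerBounds (A.ordOp i)
      {v | v ∈ A.points Set.univ (K ++ L) ∧ t v = τ} n fun s hs hsep => hn d i x s (by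
        intro v hv a ha
        obtain ⟨v', hv', hav'⟩ := hs v hv a ha
        exact hx v' (mem_points_append.1 hv'.1).1 a hav') hsep
    exact ⟨Y, h1, fun v hv hvt => h2 v ⟨hv, hvt⟩⟩)
  -- A failure at some `b` would, as `y` is in the closure, occur at a point of type `τ` and then at
  -- one in `W`, contrary to `hge`.
  have hzY : ∀ y ∈ Y, PointLE (A.ordOp i) B z y := by
    intro y hy b hb hbz
    by_contra hby
    obtain ⟨v, hv, hbv⟩ := hYcl y hy _ ((y.compl_mem_iff).2 hby)
    obtain ⟨w, hwW, hw, hwt⟩ := hR.exists_mem (K ++ L ++ [(.const, .inl (A.ordOp i b)ᶜ)])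
      (hKL.1.append (.const (hR.sub.compl_mem _ (hR.sub.ordOp_mem i hb)))) v
      (mem_points_append.2 ⟨hv.1, mem_points_const.2 hbv⟩)
    rw [mem_points_append] at hw
    exact (w.compl_mem_iff).1 (mem_points_const.1 hw.2)
      (hge w hwW hw.1 (hwt.trans hv.2) b hb hbz)
  -- If some `y` is below `z`, the constraint of being below `y` is met by `z` and confines points
  -- of `W` to those below `z`, none of which has type `τ`. Otherwise `z` meets constraints that
  -- forbid each `y` from being below a point, although every point of type `τ` has some `y` below
  -- it.
  by_cases hex : ∃ y ∈ Y, PointLE (A.ordOp i) B y z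
  · obtain ⟨y, hy, hyz⟩ := hex
    refine ⟨K ++ L ++ [(.le i, .inr y)], hKL.append ⟨.point (hYW y hy),
      mem_points_le.2 (hzY y hy)⟩, fun w hwW hw hwt => ?_⟩
    rw [mem_points_append, mem_points_append] at hw
    exact h w hwW hw.1.1 hwt
      (((mem_points_le.1 hw.2).mono (Set.subset_univ B)).trans hyz)
  · push Not at hex
    obtain ⟨L', hL', hL'Y⟩ := exists_meets_forall
      (fun y w => ¬ PointLE (A.ordOp i) B y w) Y fun y hy =>
        hR.sub.exists_meets_not_ge (W := W) (z := z) i (hex y hy)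
    refine ⟨K ++ L ++ L', hKL.append hL', fun w _ hw hwt => ?_⟩
    rw [mem_points_append] at hw
    obtain ⟨y, hy, hyw⟩ := hY w hw.1 hwt
    exact hL'Y w hw.2 y hy (hyw.mono (Set.subset_univ B))

/-- The type `τ` can be given to `z`: near `z` there are points of `W` of type `τ` on all sides. -/
def MBAO.Fits (A : MBAO M) (t : BAUltrafilter A.carrier → T) (B : Set A.carrier)
    (W : Set (BAUltrafilter A.carrier)) (z : BAUltrafilter A.carrier) (τ : T) : Prop :=
  ∀ K, A.Meets B W z K → (∃ w ∈ W, w ∈ A.points Set.univ K ∧ t w = τ) ∧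
    ∀ i, ∃ w ∈ W, w ∈ A.points Set.univ K ∧ t w = τ ∧ PointLE (A.ordOp i) B w z

/-- If every type failed, each would be expelled by some list that `z` meets. The finitely many
lists together are still met by `z`, hence by a point of `W`, which has some type. The point `x` is
needed because width bounds only antichains of successors of one point. -/
theorem MBAO.Reflects.exists_fits [Finite T] (hR : A.Reflects t B W) {n : ℕ} (hn : A.HasWidth n)
    {d : M} {x : BAUltrafilter A.carrier} (hxW : x ∈ W)
    (hxz : ∀ a ∈ B, a ∈ z.1 → A.op d a ∈ x.1) : ∃ τ, A.Fits t B W z τ := by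
  classical
  -- The clause without an order follows, as `d` provides at least one order.
  suffices h : ∃ τ, ∀ K, A.Meets B W z K → ∀ i, ∃ w ∈ W, w ∈ A.points Set.univ K ∧ t w = τ ∧
      PointLE (A.ordOp i) B w z by
    obtain ⟨τ, h⟩ := h
    refine ⟨τ, fun K hK => ⟨?_, h K hK⟩⟩
    obtain ⟨w, h1, h2, h3, _⟩ := h K hK (d, true)
    exact ⟨w, h1, h2, h3⟩
  by_contra hcon
  simp only [not_exists, not_forall, not_and] at hcon
  have := Fintype.ofFinite T
  have hx : A.Meets B W z [(.succ d, .inr x)] := ⟨.point hxW, mem_points_succ.2 hxz⟩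
  obtain ⟨L, hL, hLt⟩ := exists_meets_forall (A := A) (B := B) (W := W) (z := z)
    (fun (τ : T) w => w ∈ W → t w ≠ τ) Finset.univ fun τ _ => by
      obtain ⟨K, hK, i, h⟩ := hcon τ
      obtain ⟨L, hL, h1⟩ := hR.exists_meets_type_ne hn (hx.append hK)
        (fun v hv a ha => mem_points_succ.1 (mem_points_append.1 hv).1 a trivial ha) τ i
        fun w hw hwK => h w hw (mem_points_append.1 hwK).2
      exact ⟨L, hL, fun w hw hwW => h1 w hwW hw⟩
  obtain ⟨v, hv⟩ := hR.consistent L hL.1 z hL.2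
  obtain ⟨w, hwW, hw, _⟩ := hR.exists_mem L hL.1 v hv
  exact hLt w hw (t w) (Finset.mem_univ _) hwW rfl

/-- Adding to `K` the constraint of equality with `w` keeps it satisfiable over `B`, hence in `A₊`,
and there only `w` can satisfy it. -/
theorem MBAO.Reflects.mem_points_of_trace_eq (hR : A.Reflects t B W) {w : BAUltrafilter A.carrier}
    (hw : w ∈ W) (hzw : ∀ a ∈ B, a ∈ w.1 → a ∈ z.1) {K : List (CKind M × A.Param)}
    (hK : A.Meets B W z K) : w ∈ A.points Set.univ K := by
  have h : A.Meets B W z (K ++ [(.eq, .inr w)]) :=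
    hK.append ⟨.point hw, mem_points_eq.2 hzw⟩
  obtain ⟨v, hv⟩ := hR.consistent _ h.1 z h.2
  rw [mem_points_append] at hv
  have : w = v := BAUltrafilter.ext fun a ha => mem_points_eq.1 hv.2 a trivial ha
  exact this ▸ hv.1

theorem MBAO.Reflects.fits_of_trace_eq (hR : A.Reflects t B W) {w : BAUltrafilter A.carrier}
    (hw : w ∈ W) (hzw : ∀ a ∈ B, a ∈ w.1 → a ∈ z.1) : A.Fits t B W z (t w) := by
  have h1 := fun K hK => hR.mem_points_of_trace_eq hw hzw (K := K) hK
  refine fun K hK => ⟨⟨w, hw, h1 K hK, rfl⟩, fun i => ⟨w, hw, h1 K hK, rfl, fun b hb h => ?_⟩⟩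
  exact hzw _ (hR.sub.ordOp_mem i hb) h

/-- Equality with `w` is itself a constraint met by `z`, so traces of points of `W` have no choice
of type. -/
theorem MBAO.Fits.eq_of_trace_eq {τ : T} (h : A.Fits t B W z τ)
    {w : BAUltrafilter A.carrier} (hw : w ∈ W) (hzw : ∀ a ∈ B, a ∈ w.1 → a ∈ z.1) : τ = t w := by
  obtain ⟨w', _, h1, h2⟩ := (h [(.eq, .inr w)] ⟨.point hw, mem_points_eq.2 hzw⟩).1
  have : w = w' := BAUltrafilter.ext fun a ha => mem_points_eq.1 h1 a trivial ha
  rw [← h2, this]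

end Fits

/-! ### Subalgebras -/

/-- A subalgebra, as an algebra. -/
def MBAO.sub (A : MBAO M) {B : Set A.carrier} (hB : A.IsSubalgebra B) : MBAO M :=
  let L : BooleanSubalgebra A.carrier :=
    { carrier := B
      supClosed' := fun a ha b hb => hB.sup_mem a ha b hb
      infClosed' := fun a ha b hb => by
        have := hB.compl_mem _ (hB.sup_mem _ (hB.compl_mem a ha) _ (hB.compl_mem b hb))
        simpa using this
      compl_mem' := fun {a} ha => hB.compl_mem a ha
      bot_mem' := hB.bot_mem }
  { carrier := L
    op := fun d a => ⟨A.op d a.1, hB.op_mem d _ a.2⟩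
    op_bot := fun d => Subtype.ext (A.op_bot d)
    op_sup := fun d a b => Subtype.ext (A.op_sup d a.1 b.1) }

/-- The inclusion of a subalgebra. -/
def MBAO.subVal (A : MBAO M) {B : Set A.carrier} (hB : A.IsSubalgebra B)
    (a : (A.sub hB).carrier) : A.carrier := a.1

section Sub

variable {A : MBAO M} {B : Set A.carrier} (hB : A.IsSubalgebra B)

theorem subVal_mem (a : (A.sub hB).carrier) : A.subVal hB a ∈ B := a.2

theorem subVal_injective : Function.Injective (A.subVal hB) := Subtype.val_injective

theorem exists_subVal_eq {a : A.carrier} (ha : a ∈ B) : ∃ b, A.subVal hB b = a := ⟨⟨a, ha⟩, rfl⟩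

theorem subVal_compl (a : (A.sub hB).carrier) : A.subVal hB aᶜ = (A.subVal hB a)ᶜ := rfl

theorem subVal_sup (a b : (A.sub hB).carrier) :
    A.subVal hB (a ⊔ b) = A.subVal hB a ⊔ A.subVal hB b := rfl

theorem subVal_inf (a b : (A.sub hB).carrier) :
    A.subVal hB (a ⊓ b) = A.subVal hB a ⊓ A.subVal hB b := rfl

theorem subVal_op (d : M) (a : (A.sub hB).carrier) :
    A.subVal hB ((A.sub hB).op d a) = A.op d (A.subVal hB a) := rfl

theorem subVal_le {a b : (A.sub hB).carrier} : a ≤ b ↔ A.subVal hB a ≤ A.subVal hB b := Iff.rfl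

theorem subVal_eval (e : ℕ → (A.sub hB).carrier) (r : Term M) :
    A.subVal hB (r.eval (A.sub hB) e) = r.eval A fun i => A.subVal hB (e i) := by
  induction r with
  | var i => rfl
  | zero => rfl
  | one => rfl
  | neg r ih => rw [Term.eval, subVal_compl, ih]; rfl
  | add r r' ih ih' => rw [Term.eval, subVal_sup, ih, ih']; rfl
  | op d r ih => rw [Term.eval, subVal_op, ih]; rfl

theorem IsVariety.sub_mem {V : Set (MBAO M)} (hV : IsVariety V) (hA : A ∈ V) : A.sub hB ∈ V := by
  obtain ⟨E, hE⟩ := hV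
  rw [hE] at hA ⊢
  intro p hp e
  apply subVal_injective hB
  rw [subVal_eval, subVal_eval, hA p hp]

theorem isGeneratedBy_of_mk_le {A : MBAO M} {κ : Cardinal.{u}} (h : #A.carrier ≤ κ) :
    A.IsGeneratedBy κ :=
  ⟨Set.univ, by simpa using h, fun _ hT _ => Set.univ_subset_iff.1 hT⟩

/-- The trace of an ultrafilter on a subalgebra. -/
theorem exists_trace (v : BAUltrafilter A.carrier) :
    ∃ μ : BAUltrafilter (A.sub hB).carrier, ∀ a, a ∈ μ.1 ↔ A.subVal hB a ∈ v.1 := by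
  refine BAUltrafilter.exists_mem_iff {a | A.subVal hB a ∈ v.1} v.bot_notMem ?_ ?_ ?_
  · intro a ha b hb
    exact v.inf_mem_iff.2 ⟨ha, hb⟩
  · intro a b hab ha
    exact v.mem_of_le ((subVal_le hB).1 hab) ha
  · intro a
    exact v.2.2 _

/-- This allows ultrafilters of the subalgebra to be represented by ultrafilters of `A`, of which
only the trace on `B` matters. -/
theorem exists_extension (μ : BAUltrafilter (A.sub hB).carrier) :
    ∃ v : BAUltrafilter A.carrier, ∀ a, a ∈ μ.1 ↔ A.subVal hB a ∈ v.1 := by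
  classical
  have key : ∀ F : Finset A.carrier, (∀ a ∈ F, ∃ b ∈ μ.1, A.subVal hB b = a) →
      ∃ b ∈ μ.1, A.subVal hB b = F.inf id := by
    intro F
    induction F using Finset.induction_on with
    | empty => exact fun _ => ⟨⊤, Order.PFilter.top_mem, rfl⟩
    | insert a s _ ih =>
      intro h
      obtain ⟨b, hb, h1⟩ := ih fun a ha => h a (by simp [ha])
      obtain ⟨c, hc, h2⟩ := h a (by simp)
      refine ⟨c ⊓ b, μ.inf_mem_iff.2 ⟨hc, hb⟩, ?_⟩
      rw [subVal_inf, h1, h2, Finset.inf_insert]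
      rfl
  obtain ⟨v, hv⟩ := BAUltrafilter.exists_of_finite_inf_ne_bot
    {a | ∃ b ∈ μ.1, A.subVal hB b = a} fun F hF hbot => by
      obtain ⟨b, hb, h⟩ := key F hF
      have : b = ⊥ := subVal_injective hB (h.trans hbot)
      rw [this] at hb
      exact μ.bot_notMem hb
  refine ⟨v, fun a => ⟨fun ha => hv _ ⟨a, ha, rfl⟩, fun ha => ?_⟩⟩
  by_contra hn
  exact (v.compl_mem_iff).1 (hv _ ⟨aᶜ, (μ.compl_mem_iff).2 hn, rfl⟩) ha

end Sub

/-! ### Values of terms in complex algebras -/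

/-- A point of a frame belongs to the value of a term in the complex algebra. -/
def Frame.TermSat (F : Frame M) (e : ℕ → Set F.carrier) (r : Term M) (x : F.carrier) : Prop :=
  x ∈ (show Set F.carrier from r.eval F.complexAlgebra e)

section TermSat

variable {F : Frame M} {e : ℕ → Set F.carrier} {x : F.carrier} {r r' : Term M}

theorem termSat_one : F.TermSat e .one x ↔ True := Iff.rfl

theorem termSat_neg : F.TermSat e (.neg r) x ↔ ¬ F.TermSat e r x := Iff.rfl

theorem termSat_add : F.TermSat e (.add r r') x ↔ F.TermSat e r x ∨ F.TermSat e r' x := Iff.rfl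

theorem termSat_op {d : M} :
    F.TermSat e (.op d r) x ↔ ∃ y, F.rel d x y ∧ F.TermSat e r y :=
  ⟨fun ⟨y, h1, h2⟩ => ⟨y, h2, h1⟩, fun ⟨y, h1, h2⟩ => ⟨y, h2, h1⟩⟩

theorem eval_complexAlgebra_eq_iff :
    r.eval F.complexAlgebra e = r'.eval F.complexAlgebra e ↔
      ∀ x, F.TermSat e r x ↔ F.TermSat e r' x :=
  Set.ext_iff (a := (show Set F.carrier from r.eval F.complexAlgebra e))

end TermSat

/-- A set of terms containing the subterms of its members. -/
structure SubtermClosed (S : Set (Term M)) : Prop where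
  neg : ∀ r, .neg r ∈ S → r ∈ S
  add_left : ∀ r r', .add r r' ∈ S → r ∈ S
  add_right : ∀ r r', .add r r' ∈ S → r' ∈ S
  op : ∀ d r, .op d r ∈ S → r ∈ S

theorem SubtermClosed.union {S S' : Set (Term M)} (h : SubtermClosed S) (h' : SubtermClosed S') :
    SubtermClosed (S ∪ S') :=
  ⟨fun r hr => hr.imp (h.neg r) (h'.neg r), fun r r' hr => hr.imp (h.add_left r r') (h'.add_left r r'),
    fun r r' hr => hr.imp (h.add_right r r') (h'.add_right r r'),
    fun d r hr => hr.imp (h.op d r) (h'.op d r)⟩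

theorem SubtermClosed.insert {S : Set (Term M)} (h : SubtermClosed S) {s : Term M}
    (h1 : ∀ r, s = .neg r → r ∈ S) (h2 : ∀ r r', s = .add r r' → r ∈ S ∧ r' ∈ S)
    (h3 : ∀ d r, s = .op d r → r ∈ S) : SubtermClosed (insert s S) :=
  ⟨fun r hr => Or.inr (hr.elim (fun he => h1 r he.symm) (h.neg r)),
    fun r r' hr => Or.inr (hr.elim (fun he => (h2 r r' he.symm).1) (h.add_left r r')),
    fun r r' hr => Or.inr (hr.elim (fun he => (h2 r r' he.symm).2) (h.add_right r r')),
    fun d r hr => Or.inr (hr.elim (fun he => h3 d r he.symm) (h.op d r))⟩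

theorem exists_subtermClosed (s : Term M) :
    ∃ S : Set (Term M), S.Finite ∧ s ∈ S ∧ SubtermClosed S := by
  have hemp : SubtermClosed (∅ : Set (Term M)) :=
    ⟨fun _ h => h.elim, fun _ _ h => h.elim, fun _ _ h => h.elim, fun _ _ h => h.elim⟩
  induction s with
  | var i =>
    exact ⟨_, Set.finite_empty.insert _, Set.mem_insert _ _,
      hemp.insert (by simp) (by simp) (by simp)⟩
  | zero =>
    exact ⟨_, Set.finite_empty.insert _, Set.mem_insert _ _,
      hemp.insert (by simp) (by simp) (by simp)⟩
  | one =>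
    exact ⟨_, Set.finite_empty.insert _, Set.mem_insert _ _,
      hemp.insert (by simp) (by simp) (by simp)⟩
  | neg r ih =>
    obtain ⟨S, h1, h2, h3⟩ := ih
    exact ⟨_, h1.insert _, Set.mem_insert _ _,
      h3.insert (by rintro _ ⟨⟩; exact h2) (by simp) (by simp)⟩
  | add r r' ih ih' =>
    obtain ⟨S, h1, h2, h3⟩ := ih
    obtain ⟨S', h1', h2', h3'⟩ := ih'
    exact ⟨_, (h1.union h1').insert _, Set.mem_insert _ _,
      (h3.union h3').insert (by simp) (by rintro _ _ ⟨⟩; exact ⟨Or.inl h2, Or.inr h2'⟩) (by simp)⟩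
  | op d r ih =>
    obtain ⟨S, h1, h2, h3⟩ := ih
    exact ⟨_, h1.insert _, Set.mem_insert _ _,
      h3.insert (by simp) (by simp) (by rintro _ _ ⟨⟩; exact h2)⟩

/-! ### Varieties of finite achronal width are resolved -/

/-- The values of the terms in `S` at points of `W` can be copied to the canonical frame of the
subalgebra `B`. -/
theorem MBAO.Reflects.exists_assignment {A : MBAO M} {n : ℕ} (hn : A.HasWidth n)
    {S : Set (Term M)} (hS : S.Finite) (hSc : SubtermClosed S)
    (e : ℕ → Set A.canonicalFrame.carrier) {B : Set A.carrier} {W : Set (BAUltrafilter A.carrier)}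
    (hR : A.Reflects (T := Set S) (fun v => {r | A.canonicalFrame.TermSat e r v}) B W) :
    ∃ e' : ℕ → Set (A.sub hR.sub).canonicalFrame.carrier, ∀ w ∈ W,
      ∃ μ : (A.sub hR.sub).canonicalFrame.carrier, ∀ r ∈ S,
        ((A.sub hR.sub).canonicalFrame.TermSat e' r μ ↔ A.canonicalFrame.TermSat e r w) := by
  classical
  have := hS.to_subtype
  let F := A.canonicalFrame
  let F' := (A.sub hR.sub).canonicalFrame
  let t : BAUltrafilter A.carrier → Set S := fun v => {r | A.canonicalFrame.TermSat e r v}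
  choose ext hext using exists_extension hR.sub
  have hex : ∀ z, ∃ τ, (∃ τ, A.Fits t B W z τ) → A.Fits t B W z τ := by
    intro z
    by_cases h : ∃ τ, A.Fits t B W z τ
    · exact h.imp fun _ hτ _ => hτ
    · exact ⟨∅, fun h' => absurd h' h⟩
  choose τ hτ using hex
  -- The truth lemma is only claimed on `G`, where fitting types exist; by `hsucc` below, `G` is
  -- closed under successors over `B`.
  let G : Set (BAUltrafilter A.carrier) := {z | (∃ w ∈ W, ∀ a ∈ B, a ∈ w.1 → a ∈ z.1) ∨
    ∃ d, ∃ x ∈ W, ∀ a ∈ B, a ∈ z.1 → A.op d a ∈ x.1}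
  have hG : ∀ z ∈ G, A.Fits t B W z (τ z) := by
    rintro z (⟨w, hw, hzw⟩ | ⟨d, x, hx, hxz⟩)
    · exact hτ z ⟨_, hR.fits_of_trace_eq hw hzw⟩
    · exact hτ z (hR.exists_fits hn hx hxz)
  have hrel : ∀ d (μ ν : F'.carrier),
      F'.rel d μ ν ↔ ∀ a ∈ B, a ∈ (ext ν).1 → A.op d a ∈ (ext μ).1 := by
    intro d μ ν
    constructor
    · intro h a ha hav
      obtain ⟨b, rfl⟩ := exists_subVal_eq hR.sub ha
      exact (hext μ _).1 (h b ((hext ν b).2 hav))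
    · intro h b hb
      exact (hext μ _).2 (h _ (subVal_mem hR.sub b) ((hext ν b).1 hb))
  -- The reversed order `(d, false)` gives a point of the same type as `z` that sees over `B` all
  -- that `z` sees.
  have habove : ∀ d, ∀ z ∈ G, ∃ w ∈ W, t w = τ z ∧
      ∀ u : BAUltrafilter A.carrier, (∀ a ∈ B, a ∈ u.1 → A.op d a ∈ z.1) →
        ∀ a ∈ B, a ∈ u.1 → A.op d a ∈ w.1 := by
    intro d z hz
    obtain ⟨w, hw, -, h1, h2⟩ := (hG z hz [] .nil).2 (d, false)
    rw [pointLE_ordOp_false] at h2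
    exact ⟨w, hw, h1, fun u hu a ha hau => h2 a ha (hu a ha hau)⟩
  have hsucc : ∀ d, ∀ z ∈ G, ∀ u : BAUltrafilter A.carrier,
      (∀ a ∈ B, a ∈ u.1 → A.op d a ∈ z.1) → u ∈ G := by
    intro d z hz u hu
    obtain ⟨w, hw, -, h⟩ := habove d z hz
    exact Or.inr ⟨d, w, hw, h u hu⟩
  let e' : ℕ → Set F'.carrier := fun i => {μ | ∃ h : .var i ∈ S, ⟨.var i, h⟩ ∈ τ (ext μ)}
  have hcons : ∀ z ∈ G, ∃ w ∈ W, t w = τ z := by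
    intro z hz
    obtain ⟨w, hw, -, h⟩ := (hG z hz [] .nil).1
    exact ⟨w, hw, h⟩
  have htruth : ∀ r (hr : r ∈ S) (μ : F'.carrier), ext μ ∈ G →
      (F'.TermSat e' r μ ↔ (⟨r, hr⟩ : S) ∈ τ (ext μ)) := by
    intro r
    induction r with
    | var i =>
      intro hr μ _
      exact ⟨fun ⟨_, h⟩ => h, fun h => ⟨hr, h⟩⟩
    | zero =>
      intro hr μ hμ
      obtain ⟨w, -, h⟩ := hcons _ hμ
      rw [← h]
      exact Iff.rfl
    | one =>
      intro hr μ hμ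
      obtain ⟨w, -, h⟩ := hcons _ hμ
      rw [← h]
      exact Iff.rfl
    | neg r ih =>
      intro hr μ hμ
      obtain ⟨w, -, h⟩ := hcons _ hμ
      rw [termSat_neg, ih (hSc.neg r hr) μ hμ, ← h]
      exact Iff.rfl
    | add r r' ih ih' =>
      intro hr μ hμ
      obtain ⟨w, -, h⟩ := hcons _ hμ
      rw [termSat_add, ih (hSc.add_left r r' hr) μ hμ, ih' (hSc.add_right r r' hr) μ hμ, ← h]
      exact Iff.rfl
    | op d r ih =>
      intro hr μ hμ
      have hr' := hSc.op d r hr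
      rw [termSat_op]
      constructor
      · rintro ⟨ν, hμν, hν⟩
        rw [hrel] at hμν
        have hνG := hsucc d _ hμ _ hμν
        rw [ih hr' ν hνG] at hν
        -- Here `w` has the type of `μ` and sees `ν` over `B`, so being a successor of `w` is a
        -- constraint met by `ν`. Fitting yields a true successor `w'` of `w` with the type of `ν`.
        obtain ⟨w, hw, h1, h2⟩ := habove d _ hμ
        obtain ⟨w', -, hw', h3⟩ := (hG _ hνG [(.succ d, .inr w)]
          ⟨.point hw, mem_points_succ.2 (h2 _ hμν)⟩).1
        rw [← h3] at hν
        rw [← h1]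
        refine termSat_op.2 ⟨w', fun a ha => mem_points_succ.1 hw' a trivial ha, hν⟩
      · intro h
        -- Now `w` is taken below `μ`. A witness for the diamond at `w` reflects to some `u` in `W`;
        -- the trace of `u` is a successor of `μ` and is forced to carry the type of `u`.
        obtain ⟨w, hw, -, h1, h2⟩ := (hG _ hμ [] .nil).2 (d, true)
        rw [← h1] at h
        obtain ⟨v, hwv, hv⟩ := termSat_op.1 h
        obtain ⟨u, hu, huK, huv⟩ := hR.exists_mem [(.succ d, .inr w)] (.point hw) v
          (mem_points_succ.2 fun a _ ha => hwv a ha)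
        rw [mem_points_succ] at huK
        obtain ⟨ν, hν⟩ := exists_trace hR.sub u
        have htr : ∀ a ∈ B, a ∈ u.1 → a ∈ (ext ν).1 := by
          intro a ha hau
          obtain ⟨b, rfl⟩ := exists_subVal_eq hR.sub ha
          exact (hext ν b).1 ((hν b).2 hau)
        have hνG : ext ν ∈ G := Or.inl ⟨u, hu, htr⟩
        refine ⟨ν, fun b hb => (hext μ _).2 ?_, (ih hr' ν hνG).2 ?_⟩
        · exact h2 _ (subVal_mem hR.sub b) (huK _ trivial ((hν b).1 hb))
        · rw [(hG _ hνG).eq_of_trace_eq hu htr]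
          have : t u = t v := huv
          rw [this]
          exact hv
  refine ⟨e', fun w hw => ?_⟩
  obtain ⟨μ, hμ⟩ := exists_trace hR.sub w
  have htr : ∀ a ∈ B, a ∈ w.1 → a ∈ (ext μ).1 := by
    intro a ha haw
    obtain ⟨b, rfl⟩ := exists_subVal_eq hR.sub ha
    exact (hext μ b).1 ((hμ b).2 haw)
  have hμG : ext μ ∈ G := Or.inl ⟨w, hw, htr⟩
  refine ⟨μ, fun r hr => ?_⟩
  rw [htruth r hr μ hμG, (hG _ hμG).eq_of_trace_eq hw htr]
  exact Iff.rfl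

theorem IsVariety.totallyCanonical {V : Set (MBAO M)} (hV : IsVariety V)
    (hw : FiniteAchronalWidth (logicOf V)) (hc : CanonicalInPower (#M + ℵ₀) V) :
    TotallyCanonical V := by
  intro A hA
  by_contra hn
  obtain ⟨n, -, hU⟩ := hw
  have hwidth : A.HasWidth n := A.hasWidth_of_axiomsU n fun φ hφ => hU hφ A hA
  obtain ⟨E, hE⟩ := id hV
  rw [hE] at hn
  push Not at hn
  obtain ⟨⟨s, s'⟩, hp, e, hne⟩ := hn
  have hne' : ¬ ∀ x, A.canonicalFrame.TermSat e s x ↔ A.canonicalFrame.TermSat e s' x :=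
    fun h => hne (eval_complexAlgebra_eq_iff.2 h)
  push Not at hne'
  obtain ⟨w₀, hw₀⟩ := hne'
  obtain ⟨S, hS, hsS, hSc⟩ := exists_subtermClosed s
  obtain ⟨S', hS', hsS', hSc'⟩ := exists_subtermClosed s'
  have hfin := hS.union hS'
  have := hfin.to_subtype
  obtain ⟨B, W, hB, hwW, hR⟩ := A.exists_reflects
    (T := Set (S ∪ S' : Set (Term M))) (fun v => {r | A.canonicalFrame.TermSat e r v})
    (#M + ℵ₀) le_add_self le_self_add w₀
  obtain ⟨e', he'⟩ := hR.exists_assignment hwidth hfin (hSc.union hSc') e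
  obtain ⟨μ, hμ⟩ := he' w₀ hwW
  have hmem : (A.sub hR.sub).canonicalExtension ∈ V :=
    hc _ (hV.sub_mem hR.sub hA) (isGeneratedBy_of_mk_le hB)
  rw [hE] at hmem
  have heq := eval_complexAlgebra_eq_iff.1 (hmem _ hp e') μ
  rw [hμ s (Or.inl hsS), hμ s' (Or.inr hsS')] at heq
  rcases hw₀ with h | h
  exacts [h.2 (heq.1 h.1), h.1 (heq.2 h.2)]

/-! ### Theorems of a normal logic in an arbitrary set of atoms -/

section Subst

variable {α : Type v} {β : Type w}

theorem subst_subst {γ : Type*} (ρ : α → Formula M β) (σ : β → Formula M γ) (φ : Formula M α) :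
    (φ.subst ρ).subst σ = φ.subst fun a => (ρ a).subst σ := by
  induction φ <;> simp_all [Formula.subst]

theorem propEval_subst (ρ : α → Formula M β) (t : Formula M β → Prop) (φ : Formula M α) :
    PropEval t (φ.subst ρ) ↔ PropEval (fun χ => PropEval t (χ.subst ρ)) φ := by
  induction φ with
  | atom a => exact Iff.rfl
  | top => exact Iff.rfl
  | neg φ ih => exact not_congr ih
  | or φ ψ ih ih' => exact or_congr ih ih'
  | dia d φ => exact Iff.rfl

theorem IsTautology.subst {φ : Formula M α} (h : IsTautology φ) (ρ : α → Formula M β) :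
    IsTautology (φ.subst ρ) := fun t => (propEval_subst ρ t φ).2 (h _)

variable {t : Formula M α → Prop} {φ ψ : Formula M α}

theorem propEval_neg : PropEval t (neg φ) ↔ ¬ PropEval t φ := Iff.rfl

theorem propEval_or : PropEval t (.or φ ψ) ↔ PropEval t φ ∨ PropEval t ψ := Iff.rfl

theorem propEval_top : PropEval t .top ↔ True := Iff.rfl

theorem propEval_bot : PropEval t bot ↔ False := by simp [bot, propEval_neg, propEval_top]

theorem propEval_imp : PropEval t (imp φ ψ) ↔ (PropEval t φ → PropEval t ψ) := by
  simp [imp, propEval_neg, propEval_or, imp_iff_not_or]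

theorem propEval_and : PropEval t (.and φ ψ) ↔ PropEval t φ ∧ PropEval t ψ := by
  simp [Formula.and, propEval_neg, propEval_or]

theorem propEval_iff : PropEval t (.iff φ ψ) ↔ (PropEval t φ ↔ PropEval t ψ) := by
  simp [Formula.iff, propEval_and, propEval_imp, iff_iff_implies_and_implies]

theorem propEval_bigAnd {l : List (Formula M α)} :
    PropEval t (bigAnd l) ↔ ∀ χ ∈ l, PropEval t χ := by
  induction l with
  | nil => simp [bigAnd, propEval_top]
  | cons χ l ih =>
    have : bigAnd (χ :: l) = .and χ (bigAnd l) := rfl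
    simp [this, propEval_and, ih]

theorem propEval_bigOr {l : List (Formula M α)} :
    PropEval t (bigOr l) ↔ ∃ χ ∈ l, PropEval t χ := by
  induction l with
  | nil => simp [bigOr, propEval_bot]
  | cons χ l ih =>
    have : bigOr (χ :: l) = .or χ (bigOr l) := rfl
    simp [this, propEval_or, ih]

/-- The atoms of a formula. -/
def Formula.atoms : Formula M α → Set α
  | .atom a => {a}
  | .top => ∅
  | .neg φ => φ.atoms
  | .or φ ψ => φ.atoms ∪ ψ.atoms
  | .dia _ φ => φ.atoms

theorem finite_atoms (φ : Formula M α) : φ.atoms.Finite := by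
  induction φ with
  | atom a => exact Set.finite_singleton a
  | top => exact Set.finite_empty
  | neg φ ih => exact ih
  | or φ ψ ih ih' => exact ih.union ih'
  | dia d φ ih => exact ih

theorem subst_eq_self {φ : Formula M α} (ρ : α → Formula M α) (h : ∀ a ∈ φ.atoms, ρ a = atom a) :
    φ.subst ρ = φ := by
  induction φ with
  | atom a => exact h a rfl
  | top => rfl
  | neg φ ih => rw [Formula.subst, ih h]
  | or φ ψ ih ih' =>
    rw [Formula.subst, ih fun a ha => h a (Or.inl ha), ih' fun a ha => h a (Or.inr ha)]
  | dia d φ ih => rw [Formula.subst, ih h]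

end Subst

variable {L : Set (Formula M ℕ)}

/-- A formula has finitely many atoms, so it can be renamed injectively into the atoms `q_i` and
back. Closure properties of `L` thereby pass to arbitrary sets of atoms. -/
theorem mem_theoremsIn_iff (hL : IsNormalLogic L) {α : Type u} {χ : Formula M α} :
    χ ∈ theoremsIn L α ↔ ∀ ρ : α → Formula M ℕ, χ.subst ρ ∈ L := by
  classical
  constructor
  · rintro ⟨φ, hφ, σ, rfl⟩ ρ
    rw [subst_subst]
    exact hL.subst _ _ hφ
  · intro h
    obtain ⟨f, hf⟩ := Set.countable_iff_exists_injOn.1 (finite_atoms χ).countable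
    have hex : ∀ k, ∃ ψ : Formula M α, ∀ a ∈ χ.atoms, f a = k → ψ = atom a := by
      intro k
      by_cases hk : ∃ a ∈ χ.atoms, f a = k
      · obtain ⟨a, ha, rfl⟩ := hk
        exact ⟨atom a, fun b hb hab => by rw [hf hb ha hab]⟩
      · exact ⟨.top, fun a ha hak => absurd ⟨a, ha, hak⟩ hk⟩
    choose σ hσ using hex
    refine ⟨_, h fun a => atom (f a), σ, ?_⟩
    rw [subst_subst, subst_eq_self]
    intro a ha
    exact hσ (f a) a ha rfl

theorem theoremsIn_of_isTautology (hL : IsNormalLogic L) {α : Type u} {φ : Formula M α}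
    (h : IsTautology φ) : φ ∈ theoremsIn L α :=
  (mem_theoremsIn_iff hL).2 fun ρ => hL.taut _ (IsTautology.subst h ρ)

theorem theoremsIn_mp (hL : IsNormalLogic L) {α : Type u} {φ ψ : Formula M α}
    (h : imp φ ψ ∈ theoremsIn L α) (h' : φ ∈ theoremsIn L α) : ψ ∈ theoremsIn L α := by
  rw [mem_theoremsIn_iff hL] at *
  exact fun ρ => hL.mp _ _ (h ρ) (h' ρ)

/-- Closure under propositional consequence, which reduces later derivations to truth-functional
checks. -/
theorem theoremsIn_of_list (hL : IsNormalLogic L) {α : Type u} (l : List (Formula M α))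
    {φ : Formula M α} (hl : ∀ ψ ∈ l, ψ ∈ theoremsIn L α)
    (h : ∀ t, (∀ ψ ∈ l, PropEval t ψ) → PropEval t φ) : φ ∈ theoremsIn L α := by
  induction l generalizing φ with
  | nil => exact theoremsIn_of_isTautology hL fun t => h t (by simp)
  | cons χ l ih =>
    refine theoremsIn_mp hL (ih (φ := imp χ φ) (fun ψ hψ => hl ψ (by simp [hψ])) fun t ht => ?_)
      (hl χ (by simp))
    rw [propEval_imp]
    intro hχ
    refine h t fun ψ hψ => ?_
    rcases List.mem_cons.1 hψ with rfl | hψ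
    exacts [hχ, ht ψ hψ]

theorem theoremsIn_box (hL : IsNormalLogic L) {α : Type u} {φ : Formula M α} (d : M)
    (h : φ ∈ theoremsIn L α) : box d φ ∈ theoremsIn L α := by
  rw [mem_theoremsIn_iff hL] at *
  exact fun ρ => hL.gen d _ (h ρ)

theorem theoremsIn_axiomK (hL : IsNormalLogic L) {α : Type u} (d : M) (φ ψ : Formula M α) :
    imp (box d (imp φ ψ)) (imp (box d φ) (box d ψ)) ∈ theoremsIn L α :=
  ⟨_, hL.axiomK d, fun i => if i = 0 then φ else ψ, rfl⟩

theorem theoremsIn_dual (hL : IsNormalLogic L) {α : Type u} (d : M) (φ : Formula M α) :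
    iff (dia d φ) (neg (box d (neg φ))) ∈ theoremsIn L α :=
  ⟨_, hL.axiomDual d, fun _ => φ, rfl⟩

theorem theoremsIn_box_mono (hL : IsNormalLogic L) {α : Type u} {φ ψ : Formula M α} (d : M)
    (h : imp φ ψ ∈ theoremsIn L α) : imp (box d φ) (box d ψ) ∈ theoremsIn L α :=
  theoremsIn_mp hL (theoremsIn_axiomK hL d φ ψ) (theoremsIn_box hL d h)

theorem theoremsIn_dia_mono (hL : IsNormalLogic L) {α : Type u} {φ ψ : Formula M α} (d : M)
    (h : imp φ ψ ∈ theoremsIn L α) : imp (dia d φ) (dia d ψ) ∈ theoremsIn L α := by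
  have h1 : imp (neg ψ) (neg φ) ∈ theoremsIn L α :=
    theoremsIn_of_list hL [_] (by simpa using h) fun t ht => by
      simp only [List.mem_singleton, forall_eq, propEval_imp, propEval_neg] at ht ⊢
      tauto
  refine theoremsIn_of_list hL [imp (box d (neg ψ)) (box d (neg φ)),
    iff (dia d φ) (neg (box d (neg φ))), iff (dia d ψ) (neg (box d (neg ψ)))] ?_ fun t ht => ?_
  · simp only [List.mem_cons, List.not_mem_nil, or_false, forall_eq_or_imp, forall_eq]
    exact ⟨theoremsIn_box_mono hL d h1, theoremsIn_dual hL d φ, theoremsIn_dual hL d ψ⟩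
  · simp only [List.mem_cons, List.not_mem_nil, or_false, forall_eq_or_imp, forall_eq,
      propEval_imp, propEval_iff, propEval_neg] at ht ⊢
    tauto

theorem theoremsIn_dia_or (hL : IsNormalLogic L) {α : Type u} (d : M) (φ ψ : Formula M α) :
    imp (dia d (.or φ ψ)) (.or (dia d φ) (dia d ψ)) ∈ theoremsIn L α := by
  have h1 : imp (neg ψ) (imp (neg φ) (neg (.or φ ψ))) ∈ theoremsIn L α :=
    theoremsIn_of_isTautology hL fun t => by
      simp only [propEval_imp, propEval_neg, propEval_or]
      tauto
  refine theoremsIn_of_list hL [imp (box d (neg ψ)) (box d (imp (neg φ) (neg (.or φ ψ)))),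
    imp (box d (imp (neg φ) (neg (.or φ ψ)))) (imp (box d (neg φ)) (box d (neg (.or φ ψ)))),
    iff (dia d φ) (neg (box d (neg φ))), iff (dia d ψ) (neg (box d (neg ψ))),
    iff (dia d (.or φ ψ)) (neg (box d (neg (.or φ ψ))))] ?_ fun t ht => ?_
  · simp only [List.mem_cons, List.not_mem_nil, or_false, forall_eq_or_imp, forall_eq]
    exact ⟨theoremsIn_box_mono hL d h1, theoremsIn_axiomK hL d _ _, theoremsIn_dual hL d _,
      theoremsIn_dual hL d _, theoremsIn_dual hL d _⟩
  · have hor := propEval_or (t := t) (φ := dia d φ) (ψ := dia d ψ)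
    simp only [List.mem_cons, List.not_mem_nil, or_false, forall_eq_or_imp, forall_eq,
      propEval_imp, propEval_iff] at ht ⊢
    simp only [propEval_neg (φ := box d _)] at ht
    tauto

theorem theoremsIn_not_dia_bot (hL : IsNormalLogic L) {α : Type u} (d : M) :
    neg (dia d bot) ∈ theoremsIn L α := by
  have h1 : (neg bot : Formula M α) ∈ theoremsIn L α :=
    theoremsIn_of_isTautology hL fun t => by simp [propEval_neg, propEval_bot]
  refine theoremsIn_of_list hL [box d (neg bot), iff (dia d bot) (neg (box d (neg bot)))] ?_
    fun t ht => ?_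
  · simp only [List.mem_cons, List.not_mem_nil, or_false, forall_eq_or_imp, forall_eq]
    exact ⟨theoremsIn_box hL d h1, theoremsIn_dual hL d _⟩
  · simp only [List.mem_cons, List.not_mem_nil, or_false, forall_eq_or_imp, forall_eq,
      propEval_iff] at ht
    rw [propEval_neg]
    rw [propEval_neg] at ht
    tauto

/-! ### Maximal consistent sets -/

section Maximal

variable {α : Type u} {Γ Δ : Set (Formula M α)} {φ ψ χ : Formula M α} {d : M}

theorem exists_list_of_notMem (hL : IsNormalLogic L) (hΓ : Maximal (fun Δ => Consistent L Δ) Γ)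
    (h : χ ∉ Γ) : ∃ l : List (Formula M α), (∀ ψ ∈ l, ψ ∈ Γ) ∧
      imp (bigAnd l) (neg χ) ∈ theoremsIn L α := by
  classical
  have hn : ¬ Consistent L (insert χ Γ) := fun hc =>
    h (hΓ.2 hc (Set.subset_insert χ Γ) (Set.mem_insert χ Γ))
  rw [Consistent, not_not] at hn
  obtain ⟨l, hl, hth⟩ := hn
  refine ⟨l.filter (· ≠ χ), ?_, ?_⟩
  · intro ψ hψ
    rw [List.mem_filter] at hψ
    exact (hl ψ hψ.1).resolve_left (by simpa using hψ.2)
  · refine theoremsIn_of_list hL [_] (by simpa using hth) fun t ht => ?_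
    simp only [List.mem_singleton, forall_eq, propEval_imp, propEval_neg, propEval_bigAnd,
      List.mem_filter] at ht ⊢
    intro h1 h2
    refine ht fun ψ hψ => ?_
    by_cases he : ψ = χ
    · rwa [he]
    · exact h1 ψ ⟨hψ, by simpa using he⟩

theorem mem_of_theoremsIn (hL : IsNormalLogic L) (hΓ : Maximal (fun Δ => Consistent L Δ) Γ)
    (l : List (Formula M α)) (hl : ∀ ψ ∈ l, ψ ∈ Γ) (h : imp (bigAnd l) χ ∈ theoremsIn L α) :
    χ ∈ Γ := by
  by_contra hn
  obtain ⟨l', hl', h'⟩ := exists_list_of_notMem hL hΓ hn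
  refine hΓ.1 ⟨l ++ l', fun ψ hψ => (List.mem_append.1 hψ).elim (hl ψ) (hl' ψ), ?_⟩
  refine theoremsIn_of_list hL [imp (bigAnd l) χ, imp (bigAnd l') (neg χ)] ?_ fun t ht => ?_
  · simp only [List.mem_cons, List.not_mem_nil, or_false, forall_eq_or_imp, forall_eq]
    exact ⟨h, h'⟩
  · simp only [List.mem_cons, List.not_mem_nil, or_false, forall_eq_or_imp, forall_eq,
      propEval_imp, propEval_neg, propEval_bigAnd, List.mem_append] at ht ⊢
    exact fun h => ht.2 (fun ψ hψ => h ψ (Or.inr hψ)) (ht.1 fun ψ hψ => h ψ (Or.inl hψ))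

theorem mem_of_imp_theoremsIn (hL : IsNormalLogic L) (hΓ : Maximal (fun Δ => Consistent L Δ) Γ)
    (h : φ ∈ Γ) (h' : imp φ χ ∈ theoremsIn L α) : χ ∈ Γ := by
  refine mem_of_theoremsIn hL hΓ [φ] (by simpa using h)
    (theoremsIn_of_list hL [_] (by simpa using h') fun t ht => ?_)
  simpa [propEval_imp, propEval_bigAnd] using ht

theorem theoremsIn_subset (hL : IsNormalLogic L) (hΓ : Maximal (fun Δ => Consistent L Δ) Γ)
    (h : φ ∈ theoremsIn L α) : φ ∈ Γ := by
  refine mem_of_theoremsIn hL hΓ [] (by simp)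
    (theoremsIn_of_list hL [_] (by simpa using h) fun t ht => ?_)
  simpa [propEval_imp, propEval_bigAnd] using ht

theorem neg_mem_iff (hL : IsNormalLogic L) (hΓ : Maximal (fun Δ => Consistent L Δ) Γ) :
    neg φ ∈ Γ ↔ φ ∉ Γ := by
  constructor
  · intro h h'
    refine hΓ.1 ⟨[φ, neg φ], by simp [h, h'], theoremsIn_of_isTautology hL fun t => ?_⟩
    simp [propEval_neg, propEval_bigAnd]
  · intro h
    obtain ⟨l, hl, h'⟩ := exists_list_of_notMem hL hΓ h
    exact mem_of_theoremsIn hL hΓ l hl h'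

theorem or_mem_iff (hL : IsNormalLogic L) (hΓ : Maximal (fun Δ => Consistent L Δ) Γ) :
    .or φ ψ ∈ Γ ↔ φ ∈ Γ ∨ ψ ∈ Γ := by
  constructor
  · intro h
    by_contra hn
    push Not at hn
    rw [← neg_mem_iff hL hΓ, ← neg_mem_iff hL hΓ] at hn
    refine hΓ.1 ⟨[.or φ ψ, neg φ, neg ψ], by simp [h, hn], theoremsIn_of_isTautology hL fun t => ?_⟩
    simp only [propEval_neg, propEval_bigAnd, propEval_or, List.mem_cons, List.not_mem_nil,
      or_false, forall_eq_or_imp, forall_eq]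
    tauto
  · rintro (h | h)
    · exact mem_of_imp_theoremsIn hL hΓ h (theoremsIn_of_isTautology hL fun t => by
        rw [propEval_imp, propEval_or]; exact Or.inl)
    · exact mem_of_imp_theoremsIn hL hΓ h (theoremsIn_of_isTautology hL fun t => by
        rw [propEval_imp, propEval_or]; exact Or.inr)

theorem maximal_of_mem_or_neg_mem (hL : IsNormalLogic L) (hc : Consistent L Γ)
    (h : ∀ φ, φ ∈ Γ ∨ neg φ ∈ Γ) : Maximal (fun Δ => Consistent L Δ) Γ := by
  refine ⟨hc, fun Δ hΔ hle φ hφ => (h φ).resolve_right fun hn => ?_⟩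
  refine hΔ ⟨[φ, neg φ], by simp [hφ, hle hn], theoremsIn_of_isTautology hL fun t => ?_⟩
  simp [propEval_neg, propEval_bigAnd]

theorem Consistent.exists_maximal (h : Consistent L Γ) :
    ∃ Δ, Γ ⊆ Δ ∧ Maximal (fun Δ => Consistent L Δ) Δ := by
  refine zorn_subset_nonempty {Δ : Set (Formula M α) | Consistent L Δ} ?_ Γ h
  intro c hc hchain hne
  refine ⟨⋃₀ c, ?_, fun s hs => Set.subset_sUnion_of_mem hs⟩
  rintro ⟨l, hl, hth⟩
  have : ∃ s ∈ c, ∀ ψ ∈ l, ψ ∈ s := by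
    clear hth
    induction l with
    | nil => exact ⟨hne.some, hne.some_mem, by simp⟩
    | cons χ l ih =>
      obtain ⟨s, hs, h1⟩ := ih fun ψ hψ => hl ψ (by simp [hψ])
      obtain ⟨s', hs', h2⟩ := hl χ (by simp)
      rcases hchain.total hs hs' with hle | hle
      · refine ⟨s', hs', fun ψ hψ => ?_⟩
        rcases List.mem_cons.1 hψ with rfl | hψ
        exacts [h2, hle (h1 ψ hψ)]
      · refine ⟨s, hs, fun ψ hψ => ?_⟩
        rcases List.mem_cons.1 hψ with rfl | hψ
        exacts [hle h2, h1 ψ hψ]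
  obtain ⟨s, hs, h1⟩ := this
  exact hc hs ⟨l, h1, hth⟩

theorem exists_dia_mem_of_bigOr (hL : IsNormalLogic L)
    (hΓ : Maximal (fun Δ => Consistent L Δ) Γ) (m : List (Formula M α))
    (h : dia d (bigOr m) ∈ Γ) : ∃ ψ ∈ m, dia d ψ ∈ Γ := by
  induction m with
  | nil => exact absurd h ((neg_mem_iff hL hΓ).1
      (theoremsIn_subset hL hΓ (theoremsIn_not_dia_bot hL d)))
  | cons χ m ih =>
    have := mem_of_imp_theoremsIn hL hΓ h (theoremsIn_dia_or hL d χ (bigOr m))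
    rw [or_mem_iff hL hΓ] at this
    rcases this with h | h
    · exact ⟨χ, by simp, h⟩
    · obtain ⟨ψ, hψ, h1⟩ := ih h
      exact ⟨ψ, by simp [hψ], h1⟩

/-- The existence lemma: were `χ` inconsistent with the negations of all `ψ` for which `◇ψ ∉ Γ`,
then `χ` would imply a finite disjunction of such `ψ`, and additivity of `◇` would put some `◇ψ`
into `Γ`. -/
theorem exists_rel_of_dia_mem (hL : IsNormalLogic L)
    (Γ : (logicCanonicalFrame L α).carrier) (h : dia d χ ∈ Γ.1) :
    ∃ Δ : (logicCanonicalFrame L α).carrier, (logicCanonicalFrame L α).rel d Γ Δ ∧ χ ∈ Δ.1 := by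
  let Δ₀ : Set (Formula M α) := {φ | φ = χ ∨ ∃ ψ, φ = neg ψ ∧ dia d ψ ∉ Γ.1}
  have hc : Consistent L Δ₀ := by
    rintro ⟨l, hl, hth⟩
    have hm : ∃ m : List (Formula M α), (∀ ψ ∈ m, dia d ψ ∉ Γ.1) ∧
        ∀ t, ¬ PropEval t (bigAnd l) → PropEval t χ → PropEval t (bigOr m) := by
      clear hth
      induction l with
      | nil => exact ⟨[], by simp, fun t => by simp [propEval_bigAnd]⟩
      | cons φ l ih =>
        obtain ⟨m, hm, h1⟩ := ih fun ψ hψ => hl ψ (by simp [hψ])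
        simp only [propEval_bigAnd, propEval_bigOr, List.mem_cons, forall_eq_or_imp] at h1 ⊢
        rcases hl φ (by simp) with rfl | ⟨ψ, rfl, hψ⟩
        · exact ⟨m, hm, fun t h2 h3 => h1 t (fun h4 => h2 ⟨h3, h4⟩) h3⟩
        · refine ⟨ψ :: m, by simpa [hψ] using hm, fun t h2 h3 => ?_⟩
          by_cases h4 : PropEval t ψ
          · exact ⟨ψ, by simp, h4⟩
          · obtain ⟨θ, h5, h6⟩ := h1 t (fun h5 => h2 ⟨h4, h5⟩) h3
            exact ⟨θ, by simp [h5], h6⟩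
    obtain ⟨m, hm, h1⟩ := hm
    have h2 : imp χ (bigOr m) ∈ theoremsIn L α :=
      theoremsIn_of_list hL [_] (by simpa using hth) fun t ht => by
        rw [propEval_imp]
        exact h1 t (by simpa [propEval_neg] using ht)
    obtain ⟨ψ, hψ, h3⟩ := exists_dia_mem_of_bigOr hL Γ.2 m
      (mem_of_imp_theoremsIn hL Γ.2 h (theoremsIn_dia_mono hL d h2))
    exact hm ψ hψ h3
  obtain ⟨Δ, hΔ₀, hΔ⟩ := hc.exists_maximal
  refine ⟨⟨Δ, hΔ⟩, fun φ hφ => ?_, hΔ₀ (Or.inl rfl)⟩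
  by_contra hn
  exact (neg_mem_iff hL hΔ).1 (hΔ₀ (Or.inr ⟨φ, rfl, hn⟩)) hφ

end Maximal

/-! ### Canonical frames of logics and of algebras -/

/-- Validity is inherited by frames isomorphic to generated subframes. -/
theorem Frame.Valid.of_embedding {F F' : Frame M} {α : Type v} {φ : Formula M α}
    (h : F'.Valid φ) (f : F.carrier → F'.carrier) (hf : Function.Injective f)
    (hforth : ∀ d x y, F.rel d x y → F'.rel d (f x) (f y))
    (hback : ∀ d x y', F'.rel d (f x) y' → ∃ y, f y = y' ∧ F.rel d x y) : F.Valid φ := by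
  intro g x
  have key : ∀ (ψ : Formula M α) x, F'.Sat (fun a => f '' g a) ψ (f x) ↔ F.Sat g ψ x := by
    intro ψ
    induction ψ with
    | atom a => exact fun x => hf.mem_set_image
    | top => exact fun x => Iff.rfl
    | neg ψ ih => exact fun x => not_congr (ih x)
    | or ψ χ ih ih' => exact fun x => or_congr (ih x) (ih' x)
    | dia d ψ ih =>
      intro x
      constructor
      · rintro ⟨y', h1, h2⟩
        obtain ⟨y, rfl, h3⟩ := hback d x y' h1
        exact ⟨y, h3, (ih y).1 h2⟩
      · rintro ⟨y, h1, h2⟩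
        exact ⟨f y, hforth d x y h1, (ih y).2 h2⟩
  exact (key φ x).1 (h _ _)

/-- The algebras validating a logic. -/
def algebrasOf (L : Set (Formula M ℕ)) : Set (MBAO M) :=
  {A | ∀ φ ∈ L, ∀ e : ℕ → A.carrier, φ.toTerm.eval A e = ⊤}

theorem isVariety_algebrasOf (L : Set (Formula M ℕ)) : IsVariety (algebrasOf L) := by
  refine ⟨{p | ∃ φ ∈ L, p = (φ.toTerm, .one)}, fun A => ⟨?_, fun h φ hφ e => h _ ⟨φ, hφ, rfl⟩ e⟩⟩
  rintro h _ ⟨φ, hφ, rfl⟩ e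
  exact h φ hφ e

theorem subset_logicOf_algebrasOf (L : Set (Formula M ℕ)) : L ⊆ logicOf (algebrasOf L) :=
  fun φ hφ _ hA => hA φ hφ

theorem termSat_toTerm {F : Frame M} {e : ℕ → Set F.carrier} {φ : Formula M ℕ} {x : F.carrier} :
    F.TermSat e φ.toTerm x ↔ F.Sat e φ x := by
  induction φ generalizing x with
  | atom i => exact Iff.rfl
  | top => exact Iff.rfl
  | neg φ ih => exact not_congr ih
  | or φ ψ ih ih' => exact or_congr ih ih'
  | dia d φ ih =>
    rw [Formula.toTerm, termSat_op]
    exact exists_congr fun y => and_congr_right fun _ => ih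

theorem complexAlgebra_mem_algebrasOf_iff {F : Frame M} {L : Set (Formula M ℕ)} :
    F.complexAlgebra ∈ algebrasOf L ↔ ∀ φ ∈ L, F.Valid φ := by
  have key : ∀ (φ : Formula M ℕ) (e : ℕ → Set F.carrier),
      φ.toTerm.eval F.complexAlgebra e = ⊤ ↔ ∀ x, F.Sat e φ x := by
    intro φ e
    refine (eval_complexAlgebra_eq_iff (r' := .one)).trans (forall_congr' fun x => ?_)
    rw [termSat_toTerm, termSat_one, iff_true]
  exact forall₂_congr fun φ _ => forall_congr' fun e => key φ e

/-! #### Generated algebras -/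

/-- The value of a formula under an assignment of the atoms. -/
def Formula.value {α : Type v} (A : MBAO M) (g : α → A.carrier) : Formula M α → A.carrier
  | .atom a => g a
  | .top => ⊤
  | .neg φ => (φ.value A g)ᶜ
  | .or φ ψ => φ.value A g ⊔ ψ.value A g
  | .dia d φ => A.op d (φ.value A g)

theorem value_subst {α : Type v} (A : MBAO M) (g : α → A.carrier) (σ : ℕ → Formula M α)
    (φ : Formula M ℕ) :
    (φ.subst σ).value A g = φ.toTerm.eval A fun i => (σ i).value A g := by
  induction φ <;> simp_all [Formula.subst, Formula.value, Formula.toTerm, Term.eval]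

theorem value_bigAnd_mem {α : Type v} {A : MBAO M} {g : α → A.carrier}
    (μ : BAUltrafilter A.carrier) (l : List (Formula M α)) (h : ∀ ψ ∈ l, ψ.value A g ∈ μ.1) :
    (bigAnd l).value A g ∈ μ.1 := by
  induction l with
  | nil => exact Order.PFilter.top_mem
  | cons χ l ih =>
    have he : (bigAnd (χ :: l)).value A g = χ.value A g ⊓ (bigAnd l).value A g := by
      have : bigAnd (χ :: l) = .and χ (bigAnd l) := rfl
      simp [this, Formula.and, Formula.value]
    have := μ.inf_mem_iff.2 ⟨h χ (by simp), ih fun ψ hψ => h ψ (by simp [hψ])⟩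
    rwa [← he] at this

theorem maximal_setOf_value_mem {L : Set (Formula M ℕ)} (hL : IsNormalLogic L) {A : MBAO M}
    (hA : A ∈ algebrasOf L) {α : Type u} (g : α → A.carrier) (μ : BAUltrafilter A.carrier) :
    Maximal (fun Δ => Consistent L Δ) {φ : Formula M α | φ.value A g ∈ μ.1} := by
  refine maximal_of_mem_or_neg_mem hL ?_ fun φ => μ.2.2 _
  rintro ⟨l, hl, φ, hφ, σ, hσ⟩
  have h1 : (neg (bigAnd l)).value A g ∈ μ.1 := by
    rw [hσ, value_subst, hA φ hφ]
    exact Order.PFilter.top_mem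
  exact μ.compl_mem_iff.1 h1 (value_bigAnd_mem μ l hl)

/-- A canonical logic is valid in the canonical frames of generated algebras. -/
theorem LogicCanonicalInPower.canonicalInPower {L : Set (Formula M ℕ)} (hL : IsNormalLogic L)
    {κ : Cardinal.{u}} (hc : LogicCanonicalInPower κ L) :
    CanonicalInPower κ (algebrasOf L) := by
  rintro A hA ⟨S, hS, hgen⟩
  refine complexAlgebra_mem_algebrasOf_iff.2 fun φ hφ => ?_
  let g : S → A.carrier := Subtype.val
  -- The values of formulas in the generators form a subalgebra containing the generators. Hence
  -- ultrafilters are determined by the formulas whose values they contain.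
  have hsurj : ∀ a, ∃ χ : Formula M S, χ.value A g = a := by
    have : Set.range (fun χ : Formula M S => χ.value A g) = Set.univ := by
      refine hgen _ (fun a ha => ⟨atom ⟨a, ha⟩, rfl⟩) ⟨⟨neg top, ?_⟩, ⟨top, rfl⟩, ?_, ?_, ?_⟩
      · simp [Formula.value]
      · rintro _ ⟨χ, rfl⟩
        exact ⟨neg χ, rfl⟩
      · rintro _ ⟨χ, rfl⟩ _ ⟨χ', rfl⟩
        exact ⟨.or χ χ', rfl⟩
      · rintro d _ ⟨χ, rfl⟩
        exact ⟨dia d χ, rfl⟩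
    intro a
    exact (this ▸ Set.mem_univ a : a ∈ Set.range _)
  refine (hc S hS φ hφ).of_embedding
    (fun μ => ⟨{χ | χ.value A g ∈ μ.1}, maximal_setOf_value_mem hL hA g μ⟩) ?_ ?_ ?_
  · intro μ ν h
    refine BAUltrafilter.ext fun a ha => ?_
    obtain ⟨χ, rfl⟩ := hsurj a
    have h' : {χ : Formula M S | χ.value A g ∈ μ.1} = {χ | χ.value A g ∈ ν.1} :=
      congrArg Subtype.val h
    have : χ ∈ {χ : Formula M S | χ.value A g ∈ μ.1} := ha
    rw [h'] at this
    exact this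
  · intro d μ ν h χ hχ
    exact h _ hχ
  · intro d μ Δ h
    -- A successor `Δ` respects the order of `A`: otherwise it contains a formula of value `⊥`,
    -- whose diamond would lie in `μ`. Therefore `Δ` comes from an ultrafilter.
    have hle : ∀ χ χ' : Formula M S, χ.value A g ≤ χ'.value A g → χ ∈ Δ.1 → χ' ∈ Δ.1 := by
      intro χ χ' hle hχ
      by_contra hn
      rw [← neg_mem_iff hL Δ.2] at hn
      have hand : neg (.or (neg χ) (neg (neg χ'))) ∈ Δ.1 := by
        refine mem_of_theoremsIn hL Δ.2 [χ, neg χ'] (by simp [hχ, hn])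
          (theoremsIn_of_isTautology hL fun t => ?_)
        simp only [propEval_imp, propEval_bigAnd, propEval_neg, propEval_or, List.mem_cons,
          List.not_mem_nil, or_false, forall_eq_or_imp, forall_eq]
        tauto
      have hmem : A.op d ((neg (.or (neg χ) (neg (neg χ')))).value A g) ∈ μ.1 := h _ hand
      have hbot : (neg (.or (neg χ) (neg (neg χ')))).value A g = ⊥ := by
        simpa [Formula.value, ← sdiff_eq] using hle
      rw [hbot, A.op_bot] at hmem
      exact μ.bot_notMem hmem
    obtain ⟨ν, hν⟩ := BAUltrafilter.exists_mem_iff {a | ∃ χ ∈ Δ.1, χ.value A g = a} (by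
        rintro ⟨χ, hχ, he⟩
        have hb : χ.value A g ≤ (neg χ).value A g := by rw [he]; exact bot_le
        exact (neg_mem_iff hL Δ.2).1 (hle χ _ hb hχ) hχ) (by
        rintro _ ⟨χ, hχ, rfl⟩ _ ⟨χ', hχ', rfl⟩
        refine ⟨neg (.or (neg χ) (neg χ')), ?_, by simp [Formula.value]⟩
        refine mem_of_theoremsIn hL Δ.2 [χ, χ'] (by simp [hχ, hχ'])
          (theoremsIn_of_isTautology hL fun t => ?_)
        simp only [propEval_imp, propEval_bigAnd, propEval_neg, propEval_or, List.mem_cons,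
          List.not_mem_nil, or_false, forall_eq_or_imp, forall_eq]
        tauto) (by
        rintro _ b hab ⟨χ, hχ, rfl⟩
        obtain ⟨χ', rfl⟩ := hsurj b
        exact ⟨χ', hle χ χ' hab hχ, rfl⟩) (by
        intro a
        obtain ⟨χ, rfl⟩ := hsurj a
        by_cases hχ : χ ∈ Δ.1
        · exact Or.inl ⟨χ, hχ, rfl⟩
        · exact Or.inr ⟨neg χ, (neg_mem_iff hL Δ.2).2 hχ, rfl⟩)
    refine ⟨ν, Subtype.ext (Set.ext fun χ => ⟨fun hχ => ?_, fun hχ => (hν _).2 ⟨χ, hχ, rfl⟩⟩), ?_⟩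
    · obtain ⟨χ', hχ', he⟩ := (hν _).1 hχ
      exact hle χ' χ he.le hχ'
    · intro a ha
      obtain ⟨χ, hχ, rfl⟩ := (hν a).1 ha
      exact h χ hχ

/-! #### The algebra of definable sets of a canonical frame -/

section Definable

variable {L : Set (Formula M ℕ)} {α : Type u}

/-- The points of the canonical frame that contain a formula. -/
def pointsContaining (L : Set (Formula M ℕ)) (φ : Formula M α) :
    (logicCanonicalFrame L α).complexAlgebra.carrier :=
  ({Γ | φ ∈ Γ.1} : Set (logicCanonicalFrame L α).carrier)

theorem pointsContaining_neg (hL : IsNormalLogic L) (φ : Formula M α) :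
    pointsContaining L (neg φ) = (pointsContaining L φ)ᶜ :=
  Set.ext fun Γ => neg_mem_iff hL Γ.2

theorem pointsContaining_or (hL : IsNormalLogic L) (φ ψ : Formula M α) :
    pointsContaining L (.or φ ψ) = pointsContaining L φ ⊔ pointsContaining L ψ :=
  Set.ext fun Γ => or_mem_iff hL Γ.2

theorem pointsContaining_dia (hL : IsNormalLogic L) (d : M) (φ : Formula M α) :
    pointsContaining L (dia d φ) =
      (logicCanonicalFrame L α).complexAlgebra.op d (pointsContaining L φ) := by
  refine Set.ext fun Γ => ⟨fun h => ?_, ?_⟩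
  · obtain ⟨Δ, h1, h2⟩ := exists_rel_of_dia_mem hL Γ h
    exact ⟨Δ, h2, h1⟩
  · rintro ⟨Δ, h2, h1⟩
    exact h1 φ h2

theorem pointsContaining_eq_top (hL : IsNormalLogic L) {φ : Formula M α}
    (h : φ ∈ theoremsIn L α) : pointsContaining L φ = ⊤ :=
  Set.eq_univ_of_forall fun Γ => theoremsIn_subset hL Γ.2 h

theorem pointsContaining_subst (hL : IsNormalLogic L) (σ : ℕ → Formula M α) (φ : Formula M ℕ) :
    pointsContaining L (φ.subst σ) =
      φ.toTerm.eval (logicCanonicalFrame L α).complexAlgebra fun i => pointsContaining L (σ i) := by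
  induction φ with
  | atom i => rfl
  | top =>
    exact pointsContaining_eq_top hL (theoremsIn_of_isTautology hL fun _ => trivial)
  | neg φ ih => rw [Formula.subst, pointsContaining_neg hL, ih]; rfl
  | or φ ψ ih ih' => rw [Formula.subst, pointsContaining_or hL, ih, ih']; rfl
  | dia d φ ih => rw [Formula.subst, pointsContaining_dia hL, ih]; rfl

theorem isSubalgebra_definable (hL : IsNormalLogic L) (α : Type u) :
    (logicCanonicalFrame L α).complexAlgebra.IsSubalgebra
      (Set.range (pointsContaining L (α := α))) := by
  have htop : pointsContaining L (.top : Formula M α) = ⊤ :=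
    pointsContaining_eq_top hL (theoremsIn_of_isTautology hL fun _ => trivial)
  refine ⟨⟨neg .top, ?_⟩, ⟨.top, htop⟩, ?_, ?_, ?_⟩
  · rw [pointsContaining_neg hL, htop, compl_top]
  · rintro _ ⟨φ, rfl⟩
    exact ⟨neg φ, pointsContaining_neg hL φ⟩
  · rintro _ ⟨φ, rfl⟩ _ ⟨ψ, rfl⟩
    exact ⟨.or φ ψ, pointsContaining_or hL φ ψ⟩
  · rintro d _ ⟨φ, rfl⟩
    exact ⟨dia d φ, pointsContaining_dia hL d φ⟩

/-- The algebra of definable sets of points of the canonical frame. -/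
def definableAlgebra (hL : IsNormalLogic L) (α : Type u) : MBAO M :=
  (logicCanonicalFrame L α).complexAlgebra.sub (isSubalgebra_definable hL α)

/-- The element of the algebra of definable sets given by a formula. -/
def definableElement (hL : IsNormalLogic L) (φ : Formula M α) : (definableAlgebra hL α).carrier :=
  ⟨pointsContaining L φ, φ, rfl⟩

theorem exists_definableElement_eq (hL : IsNormalLogic L) (a : (definableAlgebra hL α).carrier) :
    ∃ φ, definableElement hL φ = a := by
  obtain ⟨φ, hφ⟩ := subVal_mem (isSubalgebra_definable hL α) a
  exact ⟨φ, Subtype.ext hφ⟩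

theorem definableElement_subst (hL : IsNormalLogic L) (σ : ℕ → Formula M α) (φ : Formula M ℕ) :
    definableElement hL (φ.subst σ) =
      φ.toTerm.eval (definableAlgebra hL α) fun i => definableElement hL (σ i) := by
  apply subVal_injective (isSubalgebra_definable hL α)
  refine (pointsContaining_subst hL σ φ).trans ?_
  exact (subVal_eval (isSubalgebra_definable hL α) (fun i => definableElement hL (σ i))
    φ.toTerm).symm

theorem definableElement_eq_top (hL : IsNormalLogic L) {φ : Formula M α}
    (h : φ ∈ theoremsIn L α) : definableElement hL φ = ⊤ :=
  Subtype.ext (pointsContaining_eq_top hL h)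

theorem definableAlgebra_mem (hL : IsNormalLogic L) (α : Type u) :
    definableAlgebra hL α ∈ algebrasOf L := by
  intro φ hφ e
  choose σ hσ using fun i => exists_definableElement_eq hL (e i)
  obtain rfl : (fun i => definableElement hL (σ i)) = e := funext hσ
  rw [← definableElement_subst]
  exact definableElement_eq_top hL ⟨φ, hφ, σ, rfl⟩

theorem definableElement_neg (hL : IsNormalLogic L) (φ : Formula M α) :
    definableElement hL (neg φ) = (definableElement hL φ)ᶜ :=
  Subtype.ext (pointsContaining_neg hL φ)

theorem definableElement_bigAnd_mem (hL : IsNormalLogic L)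
    (μ : BAUltrafilter (definableAlgebra hL α).carrier) (l : List (Formula M α))
    (h : ∀ ψ ∈ l, definableElement hL ψ ∈ μ.1) : definableElement hL (bigAnd l) ∈ μ.1 := by
  induction l with
  | nil =>
    have : definableElement hL (bigAnd ([] : List (Formula M α))) = ⊤ :=
      definableElement_eq_top hL (theoremsIn_of_isTautology hL fun _ => trivial)
    rw [this]
    exact Order.PFilter.top_mem
  | cons χ l ih =>
    have he : definableElement hL (bigAnd (χ :: l)) =
        definableElement hL χ ⊓ definableElement hL (bigAnd l) := by
      have h1 : bigAnd (χ :: l) = neg (.or (neg χ) (neg (bigAnd l))) := rfl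
      have h2 : ∀ φ ψ : Formula M α, definableElement hL (.or φ ψ) =
        definableElement hL φ ⊔ definableElement hL ψ :=
          fun φ ψ => Subtype.ext (pointsContaining_or hL φ ψ)
      rw [h1, definableElement_neg, h2, definableElement_neg, definableElement_neg, compl_sup,
        compl_compl, compl_compl]
    have := μ.inf_mem_iff.2 ⟨h χ (by simp), ih fun ψ hψ => h ψ (by simp [hψ])⟩
    rwa [← he] at this

/-- The canonical frame of a logic is isomorphic to that of its algebra of definable sets. -/
theorem logicCanonicalFrame_valid (hL : IsNormalLogic L) {φ : Formula M ℕ}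
    (h : (definableAlgebra hL α).canonicalFrame.Valid φ) : (logicCanonicalFrame L α).Valid φ := by
  -- The point `Γ` corresponds to the ultrafilter of definable sets that contain `Γ`; conversely,
  -- the formulas defining members of an ultrafilter form a maximal consistent set.
  have hf : ∀ Γ : (logicCanonicalFrame L α).carrier,
      ∃ μ : BAUltrafilter (definableAlgebra hL α).carrier,
        ∀ φ, definableElement hL φ ∈ μ.1 ↔ φ ∈ Γ.1 := by
    intro Γ
    obtain ⟨μ, hμ⟩ := BAUltrafilter.exists_mem_iff
      {a : (definableAlgebra hL α).carrier | Γ ∈ (show Set (logicCanonicalFrame L α).carrier from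
        (logicCanonicalFrame L α).complexAlgebra.subVal (isSubalgebra_definable hL α) a)}
      (fun h => h) (fun a ha b hb => ⟨ha, hb⟩) (fun a b hab ha => hab ha) (fun a => em _)
    exact ⟨μ, fun φ => hμ _⟩
  choose f hf using hf
  refine h.of_embedding f ?_ ?_ ?_
  · intro Γ Δ hΓΔ
    refine Subtype.ext (Set.ext fun φ => ?_)
    rw [← hf, ← hf, hΓΔ]
  · intro d Γ Δ hΓΔ a ha
    obtain ⟨φ, rfl⟩ := exists_definableElement_eq hL a
    have he : definableElement hL (dia d φ) =
        (definableAlgebra hL α).op d (definableElement hL φ) :=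
      Subtype.ext (pointsContaining_dia hL d φ)
    have := (hf Γ _).2 (hΓΔ φ ((hf Δ φ).1 ha))
    rwa [he] at this
  · intro d Γ ν hν
    have hmax : Maximal (fun Δ => Consistent L Δ)
        {φ : Formula M α | definableElement hL φ ∈ ν.1} := by
      refine maximal_of_mem_or_neg_mem hL ?_ fun φ => ?_
      · rintro ⟨l, hl, hth⟩
        have h1 := definableElement_eq_top hL hth
        rw [definableElement_neg, compl_eq_top] at h1
        have h2 := definableElement_bigAnd_mem hL ν l hl
        rw [h1] at h2
        exact BAUltrafilter.bot_notMem ν h2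
      · change _ ∨ definableElement hL (neg φ) ∈ ν.1
        rw [definableElement_neg]
        exact ν.2.2 _
    refine ⟨⟨_, hmax⟩, BAUltrafilter.ext fun a ha => ?_, fun φ hφ => ?_⟩
    · obtain ⟨φ, rfl⟩ := exists_definableElement_eq hL a
      exact (hf _ φ).1 ha
    · have he : definableElement hL (dia d φ) =
          (definableAlgebra hL α).op d (definableElement hL φ) :=
        Subtype.ext (pointsContaining_dia hL d φ)
      rw [← hf, he]
      exact hν _ hφ

/-- Algebraic completeness. -/
theorem logicOf_algebrasOf (hL : IsNormalLogic L) : logicOf (algebrasOf L) = L := by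
  refine Set.Subset.antisymm (fun φ hφ => ?_) (subset_logicOf_algebrasOf L)
  by_contra hn
  -- Canonical frames take their atoms in universe `u`, so the atoms `q_i` are lifted.
  let φ' : Formula M (ULift.{u} ℕ) := φ.subst fun i => atom ⟨i⟩
  have hn' : φ' ∉ theoremsIn L (ULift.{u} ℕ) := by
    intro h
    refine hn ?_
    have h1 := (mem_theoremsIn_iff hL).1 h fun i => atom i.down
    rwa [subst_subst, subst_eq_self] at h1
    intro i _
    rfl
  have hc : Consistent L {neg φ'} := by
    rintro ⟨l, hl, hth⟩
    refine hn' (theoremsIn_of_list hL [_] (by simpa using hth) fun t ht => ?_)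
    simp only [List.mem_singleton, forall_eq, propEval_neg, propEval_bigAnd] at ht
    by_contra h
    refine ht fun ψ hψ => ?_
    obtain rfl : ψ = neg φ' := hl ψ hψ
    exact h
  obtain ⟨Γ, hΓ, hmax⟩ := hc.exists_maximal
  have h1 := hφ _ (definableAlgebra_mem hL (ULift.{u} ℕ)) fun i => definableElement hL (atom ⟨i⟩)
  rw [← definableElement_subst] at h1
  have h2 : pointsContaining L φ' = ⊤ := congrArg Subtype.val h1
  have h3 : (⟨Γ, hmax⟩ : (logicCanonicalFrame L (ULift.{u} ℕ)).carrier) ∈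
      (show Set (logicCanonicalFrame L (ULift.{u} ℕ)).carrier from pointsContaining L φ') := by
    rw [h2]
    exact trivial
  exact (neg_mem_iff hL hmax).1 (hΓ rfl) h3

end Definable

theorem IsNormalLogic.totallyCanonical {L : Set (Formula M ℕ)} (hL : IsNormalLogic L)
    (hw : FiniteAchronalWidth L) (hc : LogicCanonicalInPower (#M + ℵ₀) L) :
    LogicTotallyCanonical L := by
  intro α φ hφ
  have hw' : FiniteAchronalWidth (logicOf (algebrasOf L)) := by rwa [logicOf_algebrasOf hL]
  have hV := (isVariety_algebrasOf L).totallyCanonical hw' (hc.canonicalInPower hL)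
  exact logicCanonicalFrame_valid hL
    (complexAlgebra_mem_algebrasOf_iff.1 (hV _ (definableAlgebra_mem hL α)) φ hφ)

/-! ### Logics of finite achronal width -/

theorem eval_imp_eq_top_iff {A : MBAO M} {e : ℕ → A.carrier} {φ ψ : Formula M ℕ} :
    (imp φ ψ).toTerm.eval A e = ⊤ ↔ φ.toTerm.eval A e ≤ ψ.toTerm.eval A e := by
  rw [← himp_eq_top_iff, himp_eq, sup_comm]
  rfl

/-- A criterion for the validity of the axiom `U_m` for the modalities `d` and `b`. -/
theorem axiomU_eval_eq_top (A : MBAO M) (d b : M) (m : ℕ)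
    (h : ∀ (a p : ℕ → A.carrier) (μ : BAUltrafilter A.carrier),
      (∀ i ≤ m, A.op d (p i) ∈ μ.1) → (∀ i ≤ m, p i ≤ (A.op b (a i))ᶜ) →
      (∀ i ≤ m, ∀ j ≤ m, j ≠ i → p i ≤ A.op b (a j)) → False) (e : ℕ → A.carrier) :
    (bigOr ((List.range (m + 1)).map fun i =>
      box d (imp (box b (atom i)) (bigOr (((List.range (m + 1)).filter fun j => j ≠ i).map
        fun j => box b (atom j)))))).toTerm.eval A e = ⊤ := by
  refine eq_top_of_holds fun μ => ?_
  by_contra hn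
  rw [holds_bigOr] at hn
  push Not at hn
  -- Here `p i` is the negation of the `i`-th inner implication and `a i` the negation of `q_i`, so
  -- that `■q_i` becomes the complement of the `b`-diamond of `a i`.
  refine h (fun i => (e i)ᶜ) (fun i => ((imp (box b (atom i)) (bigOr (((List.range (m + 1)).filter
    fun j => j ≠ i).map fun j => box b (atom j)))).toTerm.eval A e)ᶜ) μ ?_ ?_ ?_
  · intro i hi
    have := hn _ (List.mem_map.2 ⟨i, by simpa using by omega, rfl⟩)
    rwa [holds_box, not_not] at this
  · intro i _
    rw [compl_le_compl_iff_le]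
    exact le_sup_of_le_left (compl_compl (A.op b (e i)ᶜ)).ge
  · intro i _ j hj hji
    refine BAUltrafilter.le_of_forall_mem fun ν hν => ?_
    by_contra hnj
    refine ν.compl_mem_iff.1 hν (holds_imp.2 fun _ => holds_bigOr.2 ⟨box b (atom j), ?_, holds_box.2 hnj⟩)
    refine List.mem_map.2 ⟨j, List.mem_filter.2 ⟨by simpa using by omega, by simpa using hji⟩, rfl⟩

/-- The axiom `I_n` for `d` implies the axioms `U_m` for `d` and `b`, if `d` steps up or down along
the inclusions of the sets of `b`-successors. -/
theorem axiomU_eval_eq_top_of_axiomI (A : MBAO M) (d b : M) {n m : ℕ} (hnm : n ≤ m)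
    (hI : ∀ e : ℕ → A.carrier, (axiomI d n).toTerm.eval A e = ⊤)
    (h : (∀ c, A.op d (A.op b c) ≤ A.op b c) ∨ ∀ c, A.op d (A.op b c)ᶜ ≤ (A.op b c)ᶜ)
    (e : ℕ → A.carrier) :
    (bigOr ((List.range (m + 1)).map fun i =>
      box d (imp (box b (atom i)) (bigOr (((List.range (m + 1)).filter fun j => j ≠ i).map
        fun j => box b (atom j)))))).toTerm.eval A e = ⊤ := by
  refine axiomU_eval_eq_top A d b m (fun a p μ h1 h2 h3 => ?_) e
  have hμ := holds_of_eq_top (μ := μ) (hI p)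
  rw [axiomI, holds_imp, holds_bigAnd, holds_bigOr] at hμ
  obtain ⟨χ, hχ, hmem⟩ := hμ (by
    intro χ hχ
    obtain ⟨i, hi, rfl⟩ := List.mem_map.1 hχ
    rw [List.mem_range] at hi
    exact h1 i (by omega))
  obtain ⟨⟨i, j⟩, hij, rfl⟩ := List.mem_map.1 hχ
  simp only [List.mem_filter, List.mem_product, List.mem_range, ne_eq, decide_not,
    Bool.not_eq_eq_eq_not, Bool.not_true, decide_eq_false_iff_not] at hij
  obtain ⟨⟨hi, hj⟩, hne⟩ := hij
  rw [holds_dia] at hmem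
  -- The elements `p i` and `p j` disagree about `◆(a j)`. Also `◇(p j)` is below `◆(a i)` or below
  -- the complement of `◆(a j)`, depending on the case of `h`, and `p i` is disjoint from both.
  have hbot : (Formula.and (atom i) (.or (atom j) (dia d (atom j)))).toTerm.eval A p = ⊥ := by
    rw [← compl_eq_top]
    refine eq_top_of_holds (φ := neg (Formula.and (atom i) (.or (atom j) (dia d (atom j)))))
      fun ν => ?_
    rw [holds_neg, holds_and, holds_or, holds_atom, holds_atom, holds_dia]
    rintro ⟨hνi, hνj⟩
    have hνi1 := (ν.compl_mem_iff).1 (ν.mem_of_le (h2 i (by omega)) hνi)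
    have hνi2 := ν.mem_of_le (h3 i (by omega) j (by omega) (Ne.symm hne)) hνi
    rcases hνj with hνj | hνj
    · exact (ν.compl_mem_iff).1 (ν.mem_of_le (h2 j (by omega)) hνj) hνi2
    · rcases h with h | h
      · exact hνi1 (ν.mem_of_le
          ((A.op_mono d (h3 j (by omega) i (by omega) hne)).trans (h _)) hνj)
      · exact (ν.compl_mem_iff).1 (ν.mem_of_le
          ((A.op_mono d (h2 j (by omega))).trans (h _)) hνj) hνi2
  rw [hbot, A.op_bot] at hmem
  exact μ.bot_notMem hmem

theorem finiteAchronalWidth_of_algebras {L : Set (Formula M ℕ)} (hL : IsNormalLogic L) (m : ℕ)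
    (hm : 0 < m) (h : ∀ A ∈ algebrasOf L, ∀ (d b : M) (e : ℕ → A.carrier),
      (bigOr ((List.range (m + 1)).map fun i =>
        box d (imp (box b (atom i)) (bigOr (((List.range (m + 1)).filter fun j => j ≠ i).map
          fun j => box b (atom j)))))).toTerm.eval A e = ⊤) : FiniteAchronalWidth L := by
  refine ⟨m, hm, ?_⟩
  rintro _ ⟨d, b, rfl⟩
  rw [← logicOf_algebrasOf hL]
  exact fun A hA e => h A hA d b e

/-! ### Extensions of `K4I_n`, `K5_2` and `K5`, and linear temporal logics -/

theorem subset_smallestNormal (S : Set (Formula M ℕ)) : S ⊆ smallestNormal S :=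
  fun _ hφ _ _ hS => hS hφ

theorem finiteAchronalWidth_of_K4I {L : Set (Formula M ℕ)} (hL : IsNormalLogic L) {d : M}
    (hM : ∀ m, m = d) {n : ℕ} (h : logicK4I d n ⊆ L) : FiniteAchronalWidth L := by
  have hax := (subset_smallestNormal _).trans h
  -- The width `n + 1` instead of `n` keeps the index positive when `n = 0`.
  refine finiteAchronalWidth_of_algebras hL (n + 1) n.succ_pos fun A hA d' b e => ?_
  obtain rfl := hM d'
  obtain rfl := hM b
  refine axiomU_eval_eq_top_of_axiomI A _ _ n.le_succ (hA _ (hax (by simp))) (Or.inl fun c => ?_) e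
  have := hA (axiomFour b) (hax (by simp)) fun _ => c
  rwa [axiomFour, eval_imp_eq_top_iff] at this

/-- Width 1 suffices: a failure of `U_1` has a successor satisfying `◇(a 0)`, hence `◇◇(a 0)` at the
point itself, and another successor omitting `◇(a 0)`, which `□◇(a 0)` forbids. -/
theorem finiteAchronalWidth_of_fiveTwo {L : Set (Formula M ℕ)} (hL : IsNormalLogic L) {d : M}
    (hM : ∀ m, m = d)
    (h : ∀ A ∈ algebrasOf L, ∀ c, A.op d (A.op d c) ≤ (A.op d (A.op d c)ᶜ)ᶜ) :
    FiniteAchronalWidth L := by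
  refine finiteAchronalWidth_of_algebras hL 1 one_pos fun A hA d' b e => ?_
  obtain rfl := hM d'
  obtain rfl := hM b
  refine axiomU_eval_eq_top A _ _ 1 (fun a p μ h1 h2 h3 => ?_) e
  have h4 := μ.mem_of_le ((A.op_mono _ (h3 1 le_rfl 0 zero_le_one zero_ne_one)).trans (h A hA _))
    (h1 1 le_rfl)
  exact (μ.compl_mem_iff).1 h4 (μ.mem_of_le (A.op_mono _ (h2 0 zero_le_one)) (h1 0 zero_le_one))

theorem finiteAchronalWidth_of_K52 {L : Set (Formula M ℕ)} (hL : IsNormalLogic L) {d : M}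
    (hM : ∀ m, m = d) (h : logicK52 d ⊆ L) : FiniteAchronalWidth L := by
  refine finiteAchronalWidth_of_fiveTwo hL hM fun A hA c => ?_
  have := hA (axiomFiveTwo d) (h (subset_smallestNormal _ rfl)) fun _ => c
  rwa [axiomFiveTwo, eval_imp_eq_top_iff] at this

theorem finiteAchronalWidth_of_K5 {L : Set (Formula M ℕ)} (hL : IsNormalLogic L) {d : M}
    (hM : ∀ m, m = d) (h : logicK5 d ⊆ L) : FiniteAchronalWidth L := by
  refine finiteAchronalWidth_of_fiveTwo hL hM fun A hA c => ?_
  have h5 : ∀ c, A.op d c ≤ (A.op d (A.op d c)ᶜ)ᶜ := by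
    intro c
    have := hA (axiomFive d) (h (subset_smallestNormal _ rfl)) fun _ => c
    rwa [axiomFive, eval_imp_eq_top_iff] at this
  -- Axiom 5 gives `◇◇c ≤ ◇□◇c`, and its dual form `◇□x ≤ □x` gives `◇□◇c ≤ □◇c`.
  exact (A.op_mono d (h5 c)).trans (le_compl_comm.1 (h5 _))

/-- The converse axioms make the two diamonds conjugate; applied twice, this carries transitivity
from one diamond to the other. -/
theorem disjoint_op_iff_of_converse {A : MBAO M} {d b : M}
    (hb : ∀ c, c ≤ (A.op b (A.op d c)ᶜ)ᶜ) (hd : ∀ c, c ≤ (A.op d (A.op b c)ᶜ)ᶜ)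
    (x y : A.carrier) : Disjoint (A.op b x) y ↔ Disjoint x (A.op d y) := by
  rw [← le_compl_iff_disjoint_right, ← le_compl_iff_disjoint_right]
  constructor
  · intro h
    exact (hd x).trans (compl_le_compl (A.op_mono d (le_compl_comm.1 h)))
  · intro h
    exact (A.op_mono b h).trans (le_compl_comm.1 (hb y))

theorem finiteAchronalWidth_of_linTemporal {L : Set (Formula M ℕ)} (hL : IsNormalLogic L)
    {d b : M} (hM : ∀ m, m = d ∨ m = b) (h : logicLinTemporal d b ⊆ L) :
    FiniteAchronalWidth L := by
  have hax := (subset_smallestNormal _).trans h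
  refine finiteAchronalWidth_of_algebras hL 1 one_pos fun A hA d' b' e => ?_
  have hb : ∀ c, c ≤ (A.op b (A.op d c)ᶜ)ᶜ := fun c =>
    eval_imp_eq_top_iff.1 (hA (imp (atom 0) (box b (dia d (atom 0)))) (hax (by simp)) fun _ => c)
  have hd : ∀ c, c ≤ (A.op d (A.op b c)ᶜ)ᶜ := fun c =>
    eval_imp_eq_top_iff.1 (hA (imp (atom 0) (box d (dia b (atom 0)))) (hax (by simp)) fun _ => c)
  have h4d : ∀ c, A.op d (A.op d c) ≤ A.op d c := fun c =>
    eval_imp_eq_top_iff.1 (hA (axiomFour d) (hax (by simp)) fun _ => c)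
  have hconv := disjoint_op_iff_of_converse hb hd
  have h4b : ∀ c, A.op b (A.op b c) ≤ A.op b c := by
    intro c
    rw [← compl_compl (A.op b c), le_compl_iff_disjoint_right, compl_compl, hconv, hconv]
    refine Disjoint.mono_right (h4d _) ?_
    rw [← hconv]
    exact disjoint_compl_right
  have hId := hA (axiomI d 1) (hax (by simp))
  have hIb := hA (axiomI b 1) (hax (by simp))
  rcases hM d' with rfl | rfl <;> rcases hM b' with rfl | rfl
  · exact axiomU_eval_eq_top_of_axiomI A _ _ le_rfl hId (Or.inl h4d) e
  · refine axiomU_eval_eq_top_of_axiomI A _ _ le_rfl hId (Or.inr fun c => ?_) e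
    -- With `◇` and `◆` mutually converse, `◇¬◆c ≤ ◇¬◆◆c ≤ ¬◆c` by transitivity of `◆` and the
    -- converse axiom.
    exact (A.op_mono _ (compl_le_compl (h4b c))).trans (le_compl_comm.1 (hd _))
  · refine axiomU_eval_eq_top_of_axiomI A _ _ le_rfl hIb (Or.inr fun c => ?_) e
    exact (A.op_mono _ (compl_le_compl (h4d c))).trans (le_compl_comm.1 (hb _))
  · exact axiomU_eval_eq_top_of_axiomI A _ _ le_rfl hIb (Or.inl h4b) e

end ModalCanon

open ModalCanon
theorem mainTheorem1 (M : Type u) :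
    -- every variety of finite achronal width is resolved
    (∀ V : Set (MBAO M), IsVariety V → FiniteAchronalWidth (logicOf V) → Resolved V) ∧
    -- countable `M`, in terms of varieties and of logics
    (#M ≤ ℵ₀ →
      (∀ V : Set (MBAO M), IsVariety V → FiniteAchronalWidth (logicOf V) →
        CanonicalInPower ℵ₀ V → TotallyCanonical V) ∧
      (∀ L : Set (Formula M ℕ), IsNormalLogic L → FiniteAchronalWidth L →
        LogicCanonicalInPower ℵ₀ L → LogicTotallyCanonical L)) ∧
    -- normal logics that have finite achronal width: monomodal extensions of `K4I_n`, `K5_2`, `K5`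
    (∀ d : M, (∀ m, m = d) → ∀ L : Set (Formula M ℕ), IsNormalLogic L →
      ((∃ n, logicK4I d n ⊆ L) ∨ logicK52 d ⊆ L ∨ logicK5 d ⊆ L) → FiniteAchronalWidth L) ∧
    -- and linear temporal logics
    (∀ d b : M, d ≠ b → (∀ m, m = d ∨ m = b) → ∀ L : Set (Formula M ℕ), IsNormalLogic L →
      logicLinTemporal d b ⊆ L → FiniteAchronalWidth L) := by

  refine ⟨fun V hV hw => ?_, fun hM => ⟨fun V hV hw hc => ?_, fun L hL hw hc => ?_⟩, ?_, ?_⟩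
  · by_cases hc : CanonicalInPower (#M + ℵ₀) V
    · exact Or.inl (hV.totallyCanonical hw hc)
    · exact Or.inr hc
  · refine hV.totallyCanonical hw ?_
    rwa [Cardinal.add_eq_right le_rfl hM]
  · refine hL.totallyCanonical hw ?_
    rwa [Cardinal.add_eq_right le_rfl hM]
  · rintro d hM L hL (⟨n, h⟩ | h | h)
    exacts [finiteAchronalWidth_of_K4I hL hM h, finiteAchronalWidth_of_K52 hL hM h,
      finiteAchronalWidth_of_K5 hL hM h]
  · exact fun d b _ hM L hL h => finiteAchronalWidth_of_linTemporal hL hM h
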